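/- Let $p_{[1^23^2]}(n)$ denote the number of partitions of $n$ in which multiples of $3$ appear in four colors and all other parts in two colors, so that $\sum_{n\ge 0} p_{[1^23^2]}(n)q^n=\prod_{i\ge1}\frac{1}{(1-q^i)^2(1-q^{3i})^2}$. Then for every integer $n\ge 0$, $$p_{[1^23^2]}(5n+2)\equiv 0 \pmod 5,$$ and for all integers $n\ge 0$ and $k>0$, $$p_{[1^23^2]}\left(5^{2k}n+\frac{2\cdot 5^{2k}+1}{3}\right)\equiv p_{[1^23^2]}(25n+17)\pmod{25}.$$ -/

import Mathlib

/-- In the partitions counted by `p_{[1^k r^k]}`, a part of size `m` comes in `2k` colours if `m` is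
a multiple of `r`, and in `k` colours otherwise. -/
def numColors (k r m : ℕ) : ℕ := if r ∣ m then 2 * k else k

/-- The coloured partitions of `n` counted by `p_{[1^k r^k]}(n)`: finite multisets of coloured parts
`(m, c)`, where `m ≥ 1` is the size of the part and `c ∈ {0, …, numColors k r m - 1}` is its colour,
whose sizes add up to `n`. -/
structure ColoredPartition (k r n : ℕ) where
  /-- The coloured parts, as pairs (size, colour), with multiplicity. -/
  parts : Multiset (ℕ × ℕ)
  parts_pos : ∀ x ∈ parts, 0 < x.1
  color_lt : ∀ x ∈ parts, x.2 < numColors k r x.1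
  parts_sum : (parts.map Prod.fst).sum = n

/-- There are only finitely many coloured partitions of `n`, so that `Nat.card` is their number. -/
instance ColoredPartition.instFinite (k r n : ℕ) : Finite (ColoredPartition k r n) := by
  let S : Finset (ℕ × ℕ) := Finset.range (n + 1) ×ˢ Finset.range (2 * k + 1)
  let T : Multiset (ℕ × ℕ) := n • S.val
  have key : ∀ p : ColoredPartition k r n, p.parts ∈ T.powerset := by
    intro p
    rw [Multiset.mem_powerset, Multiset.le_iff_count]
    intro x
    by_cases hx : x ∈ p.parts
    · have hcard : p.parts.card ≤ n := by
        have h := Multiset.card_nsmul_le_sum (s := p.parts.map Prod.fst) (a := 1) (by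
          intro y hy
          obtain ⟨z, hz, rfl⟩ := Multiset.mem_map.1 hy
          exact p.parts_pos z hz)
        rw [p.parts_sum, Multiset.card_map] at h
        simpa using h
      have h1 : x.1 ≤ n := by
        have h := Multiset.le_sum_of_mem (Multiset.mem_map_of_mem Prod.fst hx)
        rwa [p.parts_sum] at h
      have h2 : x.2 < 2 * k + 1 := by
        have h := p.color_lt x hx
        unfold numColors at h
        split_ifs at h <;> omega
      have hxS : x ∈ S := by
        simp only [S, Finset.mem_product, Finset.mem_range]
        omega
      have hc : Multiset.count x S.val = 1 :=
        Multiset.count_eq_one_of_mem S.nodup hxS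
      simp only [T, Multiset.count_nsmul, hc, mul_one]
      exact (Multiset.count_le_card x p.parts).trans hcard
    · simp [Multiset.count_eq_zero_of_notMem hx]
  refine Finite.of_injective
    (fun p => (⟨p.parts, Multiset.mem_toFinset.2 (key p)⟩ : T.powerset.toFinset)) ?_
  rintro ⟨a, _, _, _⟩ ⟨b, _, _, _⟩ h
  simpa using h

/-- `p_{[1^k r^k]}(n)`: the number of partitions of `n` in which the multiples of `r` appear in `2k`
colours and all other parts in `k` colours, that is, the coefficient of `q^n` in
`∏_{i ≥ 1} 1 / ((1 - q^i)^k (1 - q^(r i))^k)`. -/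
noncomputable def coloredPartitionCount (k r n : ℕ) : ℕ := Nat.card (ColoredPartition k r n)

namespace PartitionCongruence

open PowerSeries Finset

/-! Write `E` for Euler's product and `p = (E(q) E(q³))⁻²` for the generating function. The
coefficients of `p` in the progression `5n + 2` form a series `5 g` with `g ≡ yz² S²` mod `5`, where
`yz = E(q) E(q³)` and `S = eisS` (`exists_section5_two_eq`). Extracting the exponents `≡ 3` mod `5`
sends `yz² S²` to `2 yz⁴ S`, and extracting those `≡ 1` sends that back (`section5_three`,
`section5_one`). So mod `5` the coefficients of `g` at `5(25m + 16) + 3` and `5m + 3` agree; the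
factor `5` makes this a congruence mod `25`, and `m ↦ 25m + 16` is iterated.

Modular forms are replaced by differential algebra over `𝔽₅` with `θ = q d/dq`. By Fermat,
extracting the class `r` is `1 - (θ - r)⁴`, and `f(q⁵) = f⁵`, so a section is found by four
differentiations and a fifth root (`X_pow_mul_section5_pow`). This works because `yz` times Laurent
polynomials in `S` is closed under `θ`: `θS = 1 - S⁴`, `θ(yz)/yz = 4 - S⁻¹ + 2S³`, and `q yz⁶ S =
3(1 - S⁴)` removes the remaining powers of `q`.

These relations come from lacunarity. Jacobi's series for `E³` and the pentagonal series have few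
exponent classes mod `5`, which gives second-order equations for `E`, `E³` and the `3`-dissection
part of `E³`. The cubic identity `jacobiThird_pow_three_mul` ties the levels `q` and `q³` together.
-/

/-- The finite product `(1 - X)(1 - X²)⋯(1 - Xⁿ)`. -/
noncomputable def qProd (R : Type*) [CommRing R] (n : ℕ) : R⟦X⟧ :=
  ∏ i ∈ range n, (1 - X ^ (i + 1))

/-- The Gaussian binomial coefficients in the variable `q`. -/
def gaussBinom {R : Type*} [CommRing R] (q : R) : ℕ → ℕ → R
  | _, 0 => 1
  | 0, _ + 1 => 0
  | n + 1, k + 1 => gaussBinom q n k + q ^ (k + 1) * gaussBinom q n (k + 1)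

/-! ### Gaussian binomials and the `q`-binomial theorem. -/

section GaussBinom

variable {R : Type*} [CommRing R]

@[simp] theorem gaussBinom_zero_right (q : R) (n : ℕ) : gaussBinom q n 0 = 1 := by
  cases n <;> rfl

theorem gaussBinom_succ_succ (q : R) (n k : ℕ) :
    gaussBinom q (n + 1) (k + 1) = gaussBinom q n k + q ^ (k + 1) * gaussBinom q n (k + 1) := rfl

theorem gaussBinom_eq_zero (q : R) {n k : ℕ} (h : n < k) : gaussBinom q n k = 0 := by
  induction n generalizing k with
  | zero => obtain ⟨k, rfl⟩ := Nat.exists_eq_succ_of_ne_zero h.ne'; rfl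
  | succ n ih =>
    obtain ⟨k, rfl⟩ := Nat.exists_eq_succ_of_ne_zero (Nat.ne_zero_of_lt h)
    rw [Nat.succ_eq_add_one, gaussBinom_succ_succ, ih (by omega), ih (by omega)]; simp

theorem gaussBinom_self (q : R) (n : ℕ) : gaussBinom q n n = 1 := by
  induction n with
  | zero => rfl
  | succ n ih => rw [gaussBinom_succ_succ, ih, gaussBinom_eq_zero q (Nat.lt_succ_self n)]; simp

theorem gaussBinom_mul_prod (q : R) (n k : ℕ) :
    gaussBinom q (n + k) k * (∏ i ∈ range n, (1 - q ^ (i + 1))) * ∏ i ∈ range k, (1 - q ^ (i + 1)) =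
      ∏ i ∈ range (n + k), (1 - q ^ (i + 1)) := by
  induction k generalizing n with
  | zero => simp
  | succ k ihk =>
    induction n with
    | zero => simp [gaussBinom_self]
    | succ n ihn =>
      have h1 := ihk (n + 1)
      have h2 := ihn
      rw [show n + 1 + (k + 1) = (n + 1 + k) + 1 by ring, gaussBinom_succ_succ,
        prod_range_succ _ (n + 1 + k), ← h1]
      rw [show n + (k + 1) = n + 1 + k by ring, ← h1] at h2
      rw [prod_range_succ _ k] at h2 ⊢
      rw [prod_range_succ _ n] at h2 h1 ⊢
      linear_combination (1 - q ^ (n + 1)) * q ^ (k + 1) * h2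

theorem prod_add_mul_pow (q x y : R) (n : ℕ) :
    ∏ j ∈ range n, (y + x * q ^ j) =
      ∑ k ∈ range (n + 1), q ^ (k.choose 2) * gaussBinom q n k * x ^ k * y ^ (n - k) := by
  induction n generalizing x with
  | zero => simp
  | succ n ih =>
    rw [prod_range_succ']
    have h : ∀ j, y + x * q ^ (j + 1) = y + (x * q) * q ^ j := fun j => by ring
    simp_rw [h]
    rw [ih, sum_range_succ' _ (n + 1)]
    simp only [gaussBinom_succ_succ, mul_add, add_mul, sum_add_distrib]
    have hA : ∑ k ∈ range (n + 1), q ^ (k + 1).choose 2 * gaussBinom q n k * x ^ (k + 1) *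
        y ^ (n + 1 - (k + 1)) =
        (∑ k ∈ range (n + 1), q ^ k.choose 2 * gaussBinom q n k * (x * q) ^ k * y ^ (n - k)) * x := by
      rw [sum_mul]
      refine sum_congr rfl fun k _ => ?_
      rw [Nat.add_sub_add_right, Nat.choose_succ_succ' k 1, Nat.choose_one_right]; ring
    have hB : ∑ k ∈ range (n + 1), q ^ (k + 1).choose 2 * (q ^ (k + 1) * gaussBinom q n (k + 1)) *
        x ^ (k + 1) * y ^ (n + 1 - (k + 1)) + y ^ (n + 1) =
        (∑ k ∈ range (n + 1), q ^ k.choose 2 * gaussBinom q n k * (x * q) ^ k * y ^ (n - k)) * y := by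
      rw [sum_mul, sum_range_succ, gaussBinom_eq_zero q (Nat.lt_succ_self n), sum_range_succ']
      simp only [mul_zero, zero_mul, add_zero, Nat.choose_zero_succ, pow_zero, gaussBinom_zero_right,
        Nat.sub_zero, one_mul, ← pow_succ]
      congr 1
      refine sum_congr rfl fun k hk => ?_
      have : n + 1 - (k + 1) = n - (k + 1) + 1 := by have := mem_range.1 hk; omega
      rw [this]; ring
    rw [hA]
    simp only [pow_zero, mul_one, Nat.choose_zero_succ, gaussBinom_zero_right, Nat.sub_zero, one_mul]
    linear_combination -hB

end GaussBinom

/-! ### The finite form of Jacobi's identity. -/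

section FiniteJacobi

variable {A : Type*} [CommRing A]

theorem prod_range_pow_sub_pow (q : A) (n : ℕ) :
    ∏ j ∈ range n, (q ^ n - q ^ j) =
      (-1) ^ n * q ^ (∑ j ∈ range n, j) * ∏ i ∈ range n, (1 - q ^ (i + 1)) := by
  rw [← prod_range_reflect (fun i => 1 - q ^ (i + 1)), ← prod_pow_eq_pow_sum]
  conv_rhs => rw [← card_range n, ← prod_const, card_range]
  rw [← prod_mul_distrib, ← prod_mul_distrib]
  refine prod_congr rfl fun j hj => ?_
  have : n = j + (n - 1 - j + 1) := by have := mem_range.1 hj; omega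
  conv_lhs => rw [this, pow_add]
  ring

/-- The derivative at `x = 1` of the `q`-binomial theorem for `∏ (qⁿ - x qʲ)`, `j ≤ 2n`. -/
theorem sum_gaussBinom_mul_neg_one_pow_mul (q : A) (n : ℕ) :
    ∑ k ∈ range (2 * n + 2), q ^ (k.choose 2) * gaussBinom q (2 * n + 1) k * ((-1) ^ k * k) *
      (q ^ n) ^ (2 * n + 1 - k) =
    -(-1) ^ n * q ^ (n + (∑ j ∈ range n, j) + n * n) * (∏ i ∈ range n, (1 - q ^ (i + 1))) ^ 2 := by
  have h := prod_add_mul_pow (R := Polynomial A) (Polynomial.C q) (-Polynomial.X)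
    (Polynomial.C q ^ n) (2 * n + 1)
  have hC : ∀ N k, gaussBinom (Polynomial.C q) N k = Polynomial.C (gaussBinom q N k) := by
    intro N
    induction N with
    | zero => intro k; cases k <;> simp [gaussBinom]
    | succ N ih => intro k; cases k <;> simp [gaussBinom, ih]
  have hr : ∀ k, Polynomial.C q ^ k.choose 2 * gaussBinom (Polynomial.C q) (2 * n + 1) k *
      (-Polynomial.X) ^ k * (Polynomial.C q ^ n) ^ (2 * n + 1 - k) =
      Polynomial.C (q ^ k.choose 2 * gaussBinom q (2 * n + 1) k * (-1) ^ k *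
        (q ^ n) ^ (2 * n + 1 - k)) * Polynomial.X ^ k := by
    intro k
    simp only [hC, map_mul, map_pow, map_neg, map_one]
    rw [neg_pow]
    ring
  rw [sum_congr rfl fun k _ => hr k] at h
  rw [show range (2 * n + 1) = range ((n + 1) + n) by congr 1; ring, prod_range_add,
    prod_range_succ] at h
  -- The factor `j = n` vanishes at `x = 1`, so the derivative there is minus `qⁿ` times the product
  -- of the other factors.
  have h' := congrArg (fun p => (Polynomial.derivative p).eval 1) h
  rw [show Polynomial.C q ^ n + -Polynomial.X * Polynomial.C q ^ n =
    (1 - Polynomial.X) * Polynomial.C q ^ n by ring] at h'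
  rw [show ∀ a b c : Polynomial A, a * ((1 - Polynomial.X) * c) * b =
    (1 - Polynomial.X) * (a * b * c) from fun a b c => by ring] at h'
  simp only [Polynomial.derivative_sum, Polynomial.derivative_C_mul_X_pow] at h'
  simp only [Polynomial.derivative_mul, Polynomial.eval_add, Polynomial.eval_mul,
    Polynomial.derivative_sub, Polynomial.derivative_one, Polynomial.derivative_X,
    Polynomial.eval_sub, Polynomial.eval_one, Polynomial.eval_X, sub_self, zero_mul,
    zero_sub, add_zero, Polynomial.eval_prod, Polynomial.eval_pow, one_pow, mul_one,
    Polynomial.eval_C, Polynomial.eval_neg, Polynomial.eval_finsetSum] at h'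
  have hs : ∀ k, q ^ (k.choose 2) * gaussBinom q (2 * n + 1) k * ((-1) ^ k * k) *
      (q ^ n) ^ (2 * n + 1 - k) = q ^ (k.choose 2) * gaussBinom q (2 * n + 1) k * (-1) ^ k *
      (q ^ n) ^ (2 * n + 1 - k) * k := fun k => by ring
  rw [sum_congr rfl fun k _ => hs k]
  rw [← h']
  have h1 : ∏ x ∈ range n, (q ^ n + -1 * q ^ (n + 1 + x)) =
      q ^ (n * n) * ∏ i ∈ range n, (1 - q ^ (i + 1)) := by
    rw [pow_mul]
    conv_rhs => rw [← card_range n, ← prod_const, card_range]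
    rw [← prod_mul_distrib]
    exact prod_congr rfl fun j _ => by ring
  rw [h1]
  have h2 := prod_range_pow_sub_pow q n
  simp only [neg_one_mul, ← sub_eq_add_neg]
  rw [h2]
  ring

/-- The indices `k = n - m` and `k = n + 1 + m` carry the same power of `q`, namely a common shift
plus the triangular number of `m`; this allows the terms to be paired. -/
theorem choose_two_add_eq (n m : ℕ) (h : m ≤ n) :
    (n - m).choose 2 + n * (2 * n + 1 - (n - m)) =
      (n + (∑ j ∈ range n, j) + n * n) + m * (m + 1) / 2 ∧
    (n + 1 + m).choose 2 + n * (2 * n + 1 - (n + 1 + m)) =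
      (n + (∑ j ∈ range n, j) + n * n) + m * (m + 1) / 2 := by
  obtain ⟨d, rfl⟩ := Nat.exists_eq_add_of_le h
  rw [Finset.sum_range_id, ← Nat.choose_two_right]
  have hm : m * (m + 1) / 2 = (m + 1).choose 2 := by
    rw [Nat.choose_two_right, Nat.add_sub_cancel, mul_comm]
  rw [hm, show m + d - m = d by omega, show 2 * (m + d) + 1 - d = 2 * m + d + 1 by omega,
    show 2 * (m + d) + 1 - (m + d + 1 + m) = d by omega]
  have key : ∀ k : ℕ, ((k.choose 2 : ℕ) : ℚ) = k * (k - 1) / 2 := fun k => Nat.cast_choose_two ℚ k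
  constructor
  · have : (((d.choose 2 + (m + d) * (2 * m + d + 1) : ℕ)) : ℚ) =
      ((m + d + (m + d).choose 2 + (m + d) * (m + d) + (m + 1).choose 2 : ℕ) : ℚ) := by
      push_cast; simp only [key]; push_cast; ring
    exact_mod_cast this
  · have : ((((m + d + 1 + m).choose 2 + (m + d) * d : ℕ)) : ℚ) =
      ((m + d + (m + d).choose 2 + (m + d) * (m + d) + (m + 1).choose 2 : ℕ) : ℚ) := by
      push_cast; simp only [key]; push_cast; ring
    exact_mod_cast this

/-- A finite form of Jacobi's identity for the cube of Euler's product. -/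
theorem sum_gaussBinom_eq_prod_sq [IsDomain A] (q : A) (hq : q ≠ 0)
    (h : ∀ i : ℕ, 1 - q ^ (i + 1) ≠ 0) (n : ℕ) :
    ∑ m ∈ range (n + 1), (-1) ^ m * (2 * m + 1) * q ^ (m * (m + 1) / 2) *
      gaussBinom q (2 * n + 1) (n - m) = (∏ i ∈ range n, (1 - q ^ (i + 1))) ^ 2 := by
  have key := sum_gaussBinom_mul_neg_one_pow_mul q n
  have hprod : ∀ k, ∏ i ∈ range k, (1 - q ^ (i + 1)) ≠ 0 := fun k =>
    prod_ne_zero_iff.2 fun i _ => h i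
  -- Halving the sum and reflecting the lower half pairs `n - m` with `n + 1 + m`. Their signs are
  -- opposite, so the weights combine to `(n + 1 + m) - (n - m) = 2m + 1`.
  rw [show 2 * n + 2 = (n + 1) + (n + 1) by ring, sum_range_add,
    ← sum_range_reflect _ (n + 1), ← sum_add_distrib] at key
  have hc : (-1 : A) ^ n * q ^ (n + (∑ j ∈ range n, j) + n * n) ≠ 0 :=
    mul_ne_zero (pow_ne_zero _ (by simp)) (pow_ne_zero _ hq)
  apply mul_left_cancel₀ hc
  rw [mul_sum, ← neg_inj, ← sum_neg_distrib]
  rw [neg_mul, neg_mul] at key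
  rw [← key]
  refine sum_congr rfl fun m hm => ?_
  have hm' : m ≤ n := by have := mem_range.1 hm; omega
  have hsymm : gaussBinom q (2 * n + 1) (n + 1 + m) = gaussBinom q (2 * n + 1) (n - m) := by
    have h1 := gaussBinom_mul_prod q (n + 1 + m) (n - m)
    have h2 := gaussBinom_mul_prod q (n - m) (n + 1 + m)
    rw [show n + 1 + m + (n - m) = 2 * n + 1 by omega] at h1
    rw [show n - m + (n + 1 + m) = 2 * n + 1 by omega, ← h1] at h2
    have := mul_ne_zero (hprod (n - m)) (hprod (n + 1 + m))
    apply mul_right_cancel₀ this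
    linear_combination h2
  obtain ⟨e1, e2⟩ := choose_two_add_eq n m hm'
  rw [show n + 1 - 1 - m = n - m by omega, hsymm]
  have e1' := congrArg (q ^ ·) e1
  have e2' := congrArg (q ^ ·) e2
  simp only [pow_add q (_ + n * n), pow_add q (Nat.choose _ 2), pow_mul] at e1' e2'
  have hs : (-1 : A) ^ n = (-1) ^ (n - m) * (-1) ^ m := by rw [← pow_add]; congr 1; omega
  have hs2 : (-1 : A) ^ (n + 1 + m) = -(-1) ^ (n - m) := by
    rw [show n + 1 + m = (n - m) + 2 * m + 1 by omega, pow_add, pow_add, pow_mul]; simp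
  have hs3 : (-1 : A) ^ m * (-1) ^ m = 1 := by rw [← pow_add, ← two_mul, pow_mul]; simp
  rw [hs, hs2]
  have hcast : ((n - m : ℕ) : A) = n - m := by push_cast [Nat.cast_sub hm']; ring
  rw [hcast]
  push_cast
  linear_combination (-((-1) ^ (n - m) * gaussBinom q (2 * n + 1) (n - m) * ((n : A) - m))) * e1' +
    ((-1) ^ (n - m) * gaussBinom q (2 * n + 1) (n - m) * ((n : A) + 1 + m)) * e2' - (2 * m + 1) *
    gaussBinom q (2 * n + 1) (n - m) * (-1) ^ (n - m) *
    q ^ (n + (∑ j ∈ range n, j) + n * n) * q ^ (m * (m + 1) / 2) * hs3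

end FiniteJacobi

/-! ### Euler's product and Jacobi's identity as `q`-adic limits. -/

theorem dvd_mul_sub_mul_of_dvd_sub {A : Type*} [CommRing A] {d a b a' b' : A} (h : d ∣ a - b)
    (h' : d ∣ a' - b') : d ∣ a * a' - b * b' := by
  have : a * a' - b * b' = (a - b) * a' + b * (a' - b') := by ring
  rw [this]
  exact dvd_add (h.mul_right _) (h'.mul_left _)

theorem dvd_pow_sub_pow_of_dvd_sub {A : Type*} [CommRing A] {d a b : A} (h : d ∣ a - b) (n : ℕ) :
    d ∣ a ^ n - b ^ n :=
  h.trans (sub_dvd_pow_sub_pow a b n)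

theorem eq_of_forall_X_pow_dvd_sub {R : Type*} [CommRing R] {f g : R⟦X⟧}
    (h : ∀ n : ℕ, (X : R⟦X⟧) ^ (n + 1) ∣ f - g) : f = g := by
  ext n
  have := X_pow_dvd_iff.1 (h n) n (Nat.lt_succ_self n)
  rwa [map_sub, sub_eq_zero] at this

theorem coeff_eq_of_X_pow_dvd_sub {R : Type*} [CommRing R] {f g : R⟦X⟧} {m n : ℕ}
    (h : (X : R⟦X⟧) ^ n ∣ f - g) (hm : m < n) : coeff m f = coeff m g := by
  have := X_pow_dvd_iff.1 h m hm
  rwa [map_sub, sub_eq_zero] at this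

section Euler

variable (R : Type*) [CommRing R]

theorem X_pow_dvd_qProd_sub_qProd (n k : ℕ) :
    (X : R⟦X⟧) ^ (n + 1) ∣ qProd R (n + k) - qProd R n := by
  induction k with
  | zero => simp
  | succ k ih =>
    have : qProd R (n + (k + 1)) - qProd R n =
        (qProd R (n + k) - qProd R n) - qProd R (n + k) * X ^ k * X ^ (n + 1) := by
      rw [← add_assoc, qProd, prod_range_succ, ← qProd]; ring
    rw [this]
    exact dvd_sub ih (dvd_mul_left _ _)

/-- Euler's pentagonal number theorem enters here, with an explicit precision that lets every later
limit be a divisibility by a power of `X`. -/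
theorem X_pow_dvd_qProd_sub (n : ℕ) :
    (X : R⟦X⟧) ^ (n + 1) ∣ qProd R n - pentagonalSeries R := by
  rw [X_pow_dvd_iff]
  intro m hm
  obtain ⟨s, hs⟩ := Filter.eventually_atTop.1 (coeff_prod_one_sub_X_pow_eventually_eq R m)
  obtain ⟨N, hN⟩ := s.exists_nat_subset_range
  have h1 := hs (range (n + N)) (hN.trans (range_mono (by omega)))
  rw [map_sub, ← h1, sub_eq_zero, ← qProd]
  exact (coeff_eq_of_X_pow_dvd_sub (X_pow_dvd_qProd_sub_qProd R n N) hm).symm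

theorem X_pow_dvd_qProd_sub_of_le {n k : ℕ} (h : n ≤ k) :
    (X : R⟦X⟧) ^ (n + 1) ∣ qProd R k - pentagonalSeries R :=
  (pow_dvd_pow _ (by omega)).trans (X_pow_dvd_qProd_sub R k)

@[simp] theorem constantCoeff_pentagonalSeries :
    constantCoeff (pentagonalSeries R) = 1 := by
  rw [← coeff_zero_eq_constantCoeff_apply,
    ← coeff_eq_of_X_pow_dvd_sub (X_pow_dvd_qProd_sub R 0) zero_lt_one]
  simp [qProd]

theorem isUnit_pentagonalSeries : IsUnit (pentagonalSeries R) :=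
  isUnit_iff_constantCoeff.2 (by simp)

theorem map_pentagonalSeries {S : Type*} [CommRing S] (φ : R →+* S) :
    PowerSeries.map φ (pentagonalSeries R) = pentagonalSeries S := by
  ext n
  rw [coeff_map]
  by_cases h : n ∈ Set.range pentagonal
  · obtain ⟨k, rfl⟩ := h
    simp
  · rw [coeff_pentagonalSeries_eq_zero R h, coeff_pentagonalSeries_eq_zero S h, map_zero]

end Euler

theorem one_sub_X_pow_ne_zero (i : ℕ) : (1 : ℤ⟦X⟧) - X ^ (i + 1) ≠ 0 := by
  intro h
  have := congrArg constantCoeff h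
  simp at this

/-- The Gaussian binomial is a quotient of one finite product by two, all three agreeing with
Euler's product to this order, so it approximates the inverse of that product. -/
theorem X_pow_dvd_gaussBinom_mul_sub_one {n m : ℕ} (h : m ≤ n) :
    (X : ℤ⟦X⟧) ^ (n - m + 1) ∣
      gaussBinom (X : ℤ⟦X⟧) (2 * n + 1) (n - m) * pentagonalSeries ℤ - 1 := by
  set E := pentagonalSeries ℤ with hE
  have h1 := gaussBinom_mul_prod (X : ℤ⟦X⟧) (n + 1 + m) (n - m)
  change _ * qProd ℤ (n + 1 + m) * qProd ℤ (n - m) = qProd ℤ (n + 1 + m + (n - m)) at h1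
  rw [show n + 1 + m + (n - m) = 2 * n + 1 by omega] at h1
  have a := X_pow_dvd_qProd_sub_of_le ℤ (show n - m ≤ n + 1 + m by omega)
  have b := X_pow_dvd_qProd_sub_of_le ℤ (show n - m ≤ n - m by omega)
  have c := X_pow_dvd_qProd_sub_of_le ℤ (show n - m ≤ 2 * n + 1 by omega)
  have d := dvd_mul_sub_mul_of_dvd_sub a b
  rw [← (isUnit_pentagonalSeries ℤ).dvd_mul_right]
  have : (gaussBinom (X : ℤ⟦X⟧) (2 * n + 1) (n - m) * E - 1) * E =
    (qProd ℤ (2 * n + 1) - E) - gaussBinom (X : ℤ⟦X⟧) (2 * n + 1) (n - m) *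
      (qProd ℤ (n + 1 + m) * qProd ℤ (n - m) - E * E) := by
    linear_combination h1
  rw [← hE, this]
  exact dvd_sub c (d.mul_left _)

theorem X_pow_dvd_pentagonalSeries_pow_three_sub (n : ℕ) :
    (X : ℤ⟦X⟧) ^ (n + 1) ∣ pentagonalSeries ℤ ^ 3 -
      ∑ m ∈ range (n + 1), (-1) ^ m * (2 * (m : ℤ⟦X⟧) + 1) * X ^ (m * (m + 1) / 2) := by
  have h := sum_gaussBinom_eq_prod_sq (X : ℤ⟦X⟧) X_ne_zero one_sub_X_pow_ne_zero n
  rw [← qProd] at h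
  have h1 : (X : ℤ⟦X⟧) ^ (n + 1) ∣ pentagonalSeries ℤ ^ 3 -
      qProd ℤ n ^ 2 * pentagonalSeries ℤ := by
    have := (dvd_pow_sub_pow_of_dvd_sub (X_pow_dvd_qProd_sub ℤ n) 2).mul_right (pentagonalSeries ℤ)
    rw [← dvd_neg] at this
    refine this.trans (dvd_of_eq (by ring))
  have h2 : (X : ℤ⟦X⟧) ^ (n + 1) ∣ qProd ℤ n ^ 2 * pentagonalSeries ℤ -
      ∑ m ∈ range (n + 1), (-1) ^ m * (2 * (m : ℤ⟦X⟧) + 1) * X ^ (m * (m + 1) / 2) := by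
    rw [← h, sum_mul, ← sum_sub_distrib]
    refine dvd_sum fun m hm => ?_
    have hm' : m ≤ n := by have := mem_range.1 hm; omega
    have e : ((-1) ^ m * (2 * (m : ℤ⟦X⟧) + 1) * X ^ (m * (m + 1) / 2) *
        gaussBinom X (2 * n + 1) (n - m) * pentagonalSeries ℤ -
        (-1) ^ m * (2 * (m : ℤ⟦X⟧) + 1) * X ^ (m * (m + 1) / 2) : ℤ⟦X⟧) =
        (-1) ^ m * (2 * (m : ℤ⟦X⟧) + 1) * (X ^ (m * (m + 1) / 2) *
          (gaussBinom X (2 * n + 1) (n - m) * pentagonalSeries ℤ - 1)) := by ring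
    rw [e]
    refine Dvd.dvd.mul_left ?_ _
    -- The precision lost for large `m` is regained from the triangular power of `X`, which is at
    -- least `m`.
    have hT : n + 1 ≤ m * (m + 1) / 2 + (n - m + 1) := by
      have : m ≤ m * (m + 1) / 2 := by
        rw [Nat.le_div_iff_mul_le two_pos]
        rcases m with _ | m
        · simp
        · nlinarith
      omega
    refine (pow_dvd_pow _ hT).trans ?_
    rw [pow_add]
    exact mul_dvd_mul_left _ (X_pow_dvd_gaussBinom_mul_sub_one hm')
  have := dvd_add h1 h2
  rwa [sub_add_sub_cancel] at this

/-- **Jacobi's identity** for the cube of Euler's product. -/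
theorem coeff_pentagonalSeries_pow_three (n : ℕ) :
    coeff n (pentagonalSeries ℤ ^ 3) =
      ∑ m ∈ range (n + 1), if n = m * (m + 1) / 2 then (-1) ^ m * (2 * (m : ℤ) + 1) else 0 := by
  rw [coeff_eq_of_X_pow_dvd_sub (X_pow_dvd_pentagonalSeries_pow_three_sub n) (Nat.lt_succ_self n),
    map_sum]
  refine sum_congr rfl fun m _ => ?_
  have : ((-1) ^ m * (2 * (m : ℤ⟦X⟧) + 1) * X ^ (m * (m + 1) / 2) : ℤ⟦X⟧) =
    C ((-1) ^ m * (2 * (m : ℤ) + 1)) * X ^ (m * (m + 1) / 2) := by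
    simp
  rw [this, coeff_C_mul_X_pow]

theorem coeff_pentagonalSeries_pow_three_triangle (m : ℕ) :
    coeff (m * (m + 1) / 2) (pentagonalSeries ℤ ^ 3) = (-1) ^ m * (2 * (m : ℤ) + 1) := by
  rw [coeff_pentagonalSeries_pow_three, sum_eq_single m]
  · simp
  · intro k _ hk
    rw [if_neg]
    intro h
    apply hk
    have h1 : m * (m + 1) = k * (k + 1) := by
      have := Nat.div_mul_cancel (Nat.even_mul_succ_self m).two_dvd
      have := Nat.div_mul_cancel (Nat.even_mul_succ_self k).two_dvd
      omega
    rcases lt_trichotomy k m with h2 | h2 | h2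
    · nlinarith
    · exact h2
    · nlinarith
  · intro h
    exfalso
    apply h
    rw [mem_range, Nat.lt_succ_iff, Nat.le_div_iff_mul_le two_pos]
    rcases m with _ | m
    · simp
    · nlinarith

theorem coeff_pentagonalSeries_pow_three_eq_zero {n : ℕ} (h : ∀ m : ℕ, 2 * n ≠ m * (m + 1)) :
    coeff n (pentagonalSeries ℤ ^ 3) = 0 := by
  rw [coeff_pentagonalSeries_pow_three]
  refine sum_eq_zero fun m _ => if_neg fun hm => h m ?_
  rw [hm, Nat.mul_div_cancel' (Nat.even_mul_succ_self m).two_dvd]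

/-! ### The substitutions `q ↦ qᵖ` and `q ↦ aq`. -/

section Expand

variable {R : Type*} [CommRing R]

theorem expand_injective (p : ℕ) (hp : p ≠ 0) :
    Function.Injective (expand p hp : R⟦X⟧ → R⟦X⟧) := by
  intro f g h
  ext n
  rw [← coeff_expand_mul p hp f, ← coeff_expand_mul p hp g, h]

theorem X_pow_dvd_expand {p : ℕ} (hp : p ≠ 0) {f : R⟦X⟧} {n : ℕ} (h : (X : R⟦X⟧) ^ n ∣ f) :
    (X : R⟦X⟧) ^ n ∣ expand p hp f := by
  have := map_dvd (expand p hp) h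
  rw [map_pow, expand_X] at this
  exact (pow_dvd_pow_of_dvd (dvd_pow_self _ hp) n).trans this

theorem X_pow_dvd_rescale (a : R) {f : R⟦X⟧} {n : ℕ} (h : (X : R⟦X⟧) ^ n ∣ f) :
    (X : R⟦X⟧) ^ n ∣ rescale a f := by
  have := map_dvd (rescale a) h
  rw [map_pow, rescale_X, mul_pow] at this
  exact (dvd_mul_left _ _).trans this

theorem rescale_expand_of_pow_eq_one {p : ℕ} (hp : p ≠ 0) {a : R} (ha : a ^ p = 1) (f : R⟦X⟧) :
    rescale a (expand p hp f) = expand p hp f := by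
  ext n
  rw [coeff_rescale, coeff_expand]
  split_ifs with h
  · obtain ⟨k, rfl⟩ := h
    rw [pow_mul, ha, one_pow, one_mul]
  · rw [mul_zero]

end Expand

/-! ### The `3`-dissection of `E³` and the cubic relation. -/

section Dissection

/-- For `3 ∤ n` the three conjugates of `1 - qⁿ` multiply to `1 - q³ⁿ`; for `3 ∣ n` they coincide
and give a cube. The factor in `q⁹` compensates for the missing `1 - q³ⁿ` with `3 ∣ n`. -/
theorem qProd_mul_rescale_mul_rescale {R : Type*} [CommRing R] {ω : R} (hω : ω ^ 2 + ω + 1 = 0)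
    (m : ℕ) :
    qProd R (3 * m) * rescale ω (qProd R (3 * m)) * rescale (ω ^ 2) (qProd R (3 * m)) *
      expand 9 (by norm_num) (qProd R m) =
    expand 3 (by norm_num) (qProd R (3 * m)) * expand 3 (by norm_num) (qProd R m) ^ 3 := by
  have hc : (C ω : R⟦X⟧) ^ 2 + C ω + 1 = 0 := by
    rw [← map_pow, ← map_one (C (R := R)), ← map_add, ← map_add, hω, map_zero]
  have h3 : ω ^ 3 = 1 := by linear_combination (ω - 1) * hω
  induction m with
  | zero => simp [qProd]
  | succ m ih =>
    have hs : ∀ k, qProd R (k + 1) = qProd R k * (1 - X ^ (k + 1)) := fun k => prod_range_succ _ _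
    have hr : ∀ (a : R) k, rescale a (1 - X ^ k : R⟦X⟧) = 1 - C (a ^ k) * X ^ k := by
      intro a k
      rw [map_sub, map_one, map_pow, rescale_X, mul_pow, map_pow]
    have hω1 : ω ^ (3 * m + 1) = ω := by rw [pow_succ, pow_mul, h3]; simp
    have hω2 : ω ^ (3 * m + 1 + 1) = ω ^ 2 := by rw [pow_succ, hω1, sq]
    have hω3 : ω ^ (3 * m + 2 + 1) = 1 := by
      rw [show 3 * m + 2 + 1 = 3 * (m + 1) by ring, pow_mul, h3, one_pow]
    rw [show 3 * (m + 1) = 3 * m + 1 + 1 + 1 by ring, hs (3 * m + 2), hs (3 * m + 1), hs (3 * m),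
      hs m]
    simp only [map_mul, hr, map_sub, map_one, expand_X, map_pow, ← pow_mul, mul_comm 2 (_ + _)]
    simp only [pow_mul ω, hω1, hω2, hω3, ← map_pow (C (R := R))] at ih ⊢
    simp only [← pow_mul, map_pow, one_pow, map_one, one_mul] at ih ⊢
    have e1 : (1 - X ^ (3 * m + 1)) * (1 - C ω * X ^ (3 * m + 1)) *
        (1 - C ω ^ 2 * X ^ (3 * m + 1)) = (1 - X ^ (3 * (3 * m + 1)) : R⟦X⟧) := by
      rw [mul_comm 3 (3 * m + 1), pow_mul _ _ 3]
      generalize (X : R⟦X⟧) ^ (3 * m + 1) = x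
      linear_combination (-x + C ω * x ^ 2 - (C ω - 1) * x ^ 3) * hc
    have e2 : (1 - X ^ (3 * m + 1 + 1)) * (1 - C ω ^ 2 * X ^ (3 * m + 1 + 1)) *
        (1 - C ω ^ (2 * 2) * X ^ (3 * m + 1 + 1)) = (1 - X ^ (3 * (3 * m + 1 + 1)) : R⟦X⟧) := by
      rw [mul_comm 3 (3 * m + 1 + 1), pow_mul _ _ 3]
      generalize (X : R⟦X⟧) ^ (3 * m + 1 + 1) = x
      have h3' : (C ω : R⟦X⟧) ^ 3 = 1 := by rw [← map_pow, h3, map_one]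
      rw [show (C ω : R⟦X⟧) ^ (2 * 2) = C ω by linear_combination C ω * h3']
      linear_combination (-x + C ω * x ^ 2 - (C ω - 1) * x ^ 3) * hc
    have e3 : (X : R⟦X⟧) ^ (9 * (m + 1)) = X ^ (3 * (3 * m + 2 + 1)) := by congr 1; ring
    have e4 : (X : R⟦X⟧) ^ (3 * (m + 1)) = X ^ (3 * m + 2 + 1) := by congr 1
    rw [e3, e4]
    linear_combination (1 - X ^ (3 * m + 2 + 1)) ^ 3 * (1 - X ^ (3 * (3 * m + 2 + 1))) * (
      ((1 - X ^ (3 * m + 1)) * (1 - C ω * X ^ (3 * m + 1)) *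
        (1 - C ω ^ 2 * X ^ (3 * m + 1))) * ((1 - X ^ (3 * m + 1 + 1)) *
        (1 - C ω ^ 2 * X ^ (3 * m + 1 + 1)) *
        (1 - C ω ^ (2 * 2) * X ^ (3 * m + 1 + 1))) * ih +
      expand 3 (by norm_num) (qProd R (3 * m)) * expand 3 (by norm_num) (qProd R m) ^ 3 *
      (e1 * ((1 - X ^ (3 * m + 1 + 1)) * (1 - C ω ^ 2 * X ^ (3 * m + 1 + 1)) *
        (1 - C ω ^ (2 * 2) * X ^ (3 * m + 1 + 1))) + (1 - X ^ (3 * (3 * m + 1)) : R⟦X⟧) * e2))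

theorem pentagonalSeries_mul_rescale_mul_rescale {R : Type*} [CommRing R] {ω : R}
    (hω : ω ^ 2 + ω + 1 = 0) :
    pentagonalSeries R * rescale ω (pentagonalSeries R) * rescale (ω ^ 2) (pentagonalSeries R) *
      expand 9 (by norm_num) (pentagonalSeries R) =
    expand 3 (by norm_num) (pentagonalSeries R) ^ 4 := by
  refine eq_of_forall_X_pow_dvd_sub fun n => ?_
  have h := qProd_mul_rescale_mul_rescale hω n
  have h1 := X_pow_dvd_qProd_sub_of_le R (show n ≤ n by omega)
  have h3 := X_pow_dvd_qProd_sub_of_le R (show n ≤ 3 * n by omega)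
  have r1 := X_pow_dvd_rescale ω h3
  have r2 := X_pow_dvd_rescale (ω ^ 2) h3
  have s1 := X_pow_dvd_expand (p := 9) (by norm_num) h1
  have s2 := X_pow_dvd_expand (p := 3) (by norm_num) h1
  have s3 := X_pow_dvd_expand (p := 3) (by norm_num) h3
  rw [map_sub] at r1 r2 s1 s2 s3
  have l := dvd_mul_sub_mul_of_dvd_sub (dvd_mul_sub_mul_of_dvd_sub
    (dvd_mul_sub_mul_of_dvd_sub h3 r1) r2) s1
  have r := dvd_mul_sub_mul_of_dvd_sub s3 (dvd_pow_sub_pow_of_dvd_sub s2 3)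
  rw [h] at l
  have := dvd_sub r l
  rw [sub_sub_sub_cancel_left] at this
  refine this.trans (dvd_of_eq (by ring))

/-- The part of Jacobi's series `∏ (1 - qⁿ)³` with exponents divisible by `3`,
as a series in `q³`. -/
noncomputable def jacobiThird : ℤ⟦X⟧ := mk fun n => coeff (3 * n) (pentagonalSeries ℤ ^ 3)

/-- A triangular number is divisible by `3` unless its index is `3j + 1`. It is then `9 j(j+1)/2 +
1`, with Jacobi coefficient `-3` times that of `j`. -/
theorem pentagonalSeries_pow_three_eq :
    pentagonalSeries ℤ ^ 3 = expand 3 (by norm_num) jacobiThird -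
      3 * X * expand 9 (by norm_num) (pentagonalSeries ℤ ^ 3) := by
  ext n
  rw [map_sub, show (3 : ℤ⟦X⟧) = C 3 from rfl, mul_assoc, coeff_C_mul]
  by_cases h0 : 3 ∣ n
  · obtain ⟨k, rfl⟩ := h0
    rw [coeff_expand_mul, jacobiThird, coeff_mk]
    have : coeff (3 * k) (X * expand 9 (by norm_num) (pentagonalSeries ℤ ^ 3)) = 0 := by
      rcases k with _ | k
      · simp
      · rw [show 3 * (k + 1) = 3 * k + 2 + 1 by ring, coeff_succ_X_mul]
        exact coeff_expand_of_not_dvd _ _ _ (by omega)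
    rw [this]; simp
  · rw [coeff_expand_of_not_dvd _ _ _ h0, zero_sub]
    obtain ⟨k, rfl⟩ := Nat.exists_eq_succ_of_ne_zero (show n ≠ 0 by rintro rfl; simp at h0)
    rw [Nat.succ_eq_add_one, coeff_succ_X_mul]
    by_cases ht : ∃ m : ℕ, 2 * (k + 1) = m * (m + 1)
    · obtain ⟨m, hm⟩ := ht
      have hm3 : m % 3 = 1 := by
        have h1 : m % 3 = 0 ∨ m % 3 = 1 ∨ m % 3 = 2 := by omega
        rcases h1 with h | h | h
        · exfalso
          obtain ⟨c, rfl⟩ : 3 ∣ m := by omega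
          exact h0 (by have : 2 * (k + 1) = 3 * (c * (3 * c + 1)) := by rw [hm]; ring
                       omega)
        · exact h
        · exfalso
          obtain ⟨c, hc⟩ : 3 ∣ m + 1 := by omega
          exact h0 (by have : 2 * (k + 1) = 3 * (m * c) := by rw [hm, hc]; ring
                       omega)
      obtain ⟨j, rfl⟩ : ∃ j, m = 3 * j + 1 := ⟨m / 3, by omega⟩
      have hk : k = 9 * (j * (j + 1) / 2) := by
        have := Nat.mul_div_cancel' (Nat.even_mul_succ_self j).two_dvd
        have h2 : 2 * (k + 1) = 9 * (j * (j + 1)) + 2 := by rw [hm]; ring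
        omega
      have hk' : k + 1 = (3 * j + 1) * (3 * j + 1 + 1) / 2 := by omega
      conv_lhs => rw [hk']
      rw [hk, coeff_expand_mul, coeff_pentagonalSeries_pow_three_triangle,
        coeff_pentagonalSeries_pow_three_triangle]
      rw [pow_succ, pow_mul]
      push_cast
      norm_num
      ring
    · push Not at ht
      rw [coeff_pentagonalSeries_pow_three_eq_zero ht, coeff_expand]
      split_ifs with h9
      · obtain ⟨c, rfl⟩ := h9
        rw [Nat.mul_div_cancel_left _ (by norm_num), coeff_pentagonalSeries_pow_three_eq_zero]
        · simp
        · intro m hm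
          apply ht (3 * m + 1)
          have : (3 * m + 1) * (3 * m + 1 + 1) = 9 * (m * (m + 1)) + 2 := by ring
          rw [this, ← hm]; ring
      · simp

/-- The cubic relation between Euler products at `q` and `q³`. -/
theorem jacobiThird_pow_three_mul :
    jacobiThird ^ 3 * expand 3 (by norm_num) (pentagonalSeries ℤ) ^ 3 =
      pentagonalSeries ℤ ^ 12 + 27 * X * expand 3 (by norm_num) (pentagonalSeries ℤ) ^ 12 := by
  have hprim := Complex.isPrimitiveRoot_exp 3 (by norm_num)
  obtain ⟨ω, hω⟩ : ∃ ω : ℂ, ω ^ 2 + ω + 1 = 0 := by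
    refine ⟨Complex.exp (2 * Real.pi * Complex.I / (3 : ℕ)), ?_⟩
    have := hprim.geom_sum_eq_zero (by norm_num)
    simp only [sum_range_succ, range_zero, sum_empty] at this
    linear_combination this
  have h3 : ω ^ 3 = 1 := by linear_combination (ω - 1) * hω
  have hd := congrArg (PowerSeries.map (Int.castRingHom ℂ)) pentagonalSeries_pow_three_eq
  rw [map_sub, map_mul, map_mul, map_expand, map_expand, map_pow, map_pentagonalSeries, map_X,
    map_ofNat] at hd
  have hinj : Function.Injective (PowerSeries.map (Int.castRingHom ℂ)) :=
    PowerSeries.map_injective _ (RingHom.injective_int _)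
  apply hinj
  simp only [map_mul, map_add, map_pow, map_expand, map_pentagonalSeries, map_X, map_ofNat]
  set f := PowerSeries.map (Int.castRingHom ℂ) jacobiThird
  set E := pentagonalSeries ℂ with hE
  -- The cubic relation is the norm of the dissection: multiply its three conjugates under `q ↦ ωq`.
  -- The result is the desired identity with `q³` in place of `q`.
  have hd1 := congrArg (rescale ω) hd
  have hd2 := congrArg (rescale (ω ^ 2)) hd
  have h9 : ω ^ 9 = 1 := by rw [show 9 = 3 * 3 by norm_num, pow_mul, h3, one_pow]
  simp only [map_sub, map_mul, rescale_X, map_ofNat, map_pow (rescale _)] at hd1 hd2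
  rw [rescale_expand_of_pow_eq_one _ h3, rescale_expand_of_pow_eq_one _ h9] at hd1
  rw [rescale_expand_of_pow_eq_one _ (by rw [← pow_mul, mul_comm, pow_mul, h3, one_pow]),
    rescale_expand_of_pow_eq_one _ (by rw [← pow_mul, mul_comm, pow_mul, h9, one_pow])] at hd2
  have hprod := pentagonalSeries_mul_rescale_mul_rescale hω
  rw [← hE] at hprod
  apply expand_injective 3 (by norm_num)
  have e9 : ∀ g : ℂ⟦X⟧, expand 3 (by norm_num) (expand 3 (by norm_num) g) =
      expand 9 (by norm_num) g := fun g => by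
    rw [← expand_mul]
  simp only [map_mul, map_add, map_pow, map_ofNat, expand_X, e9] at hd hd1 hd2 ⊢
  have hc : (C ω : ℂ⟦X⟧) ^ 2 + C ω + 1 = 0 := by
    rw [← map_pow, ← map_one (C (R := ℂ)), ← map_add, ← map_add, hω, map_zero]
  have hc3 : (C ω : ℂ⟦X⟧) ^ 3 = 1 := by rw [← map_pow, h3, map_one]
  set a := expand 3 (by norm_num : 3 ≠ 0) f
  set b := expand 9 (by norm_num : 9 ≠ 0) E
  set c := expand 3 (by norm_num : 3 ≠ 0) E
  -- The dissection describes `E³`, so the norm identity for `E` is cubed first.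
  have hP := congrArg (· ^ 3) hprod
  simp only [mul_pow] at hP
  rw [hd1, hd2, hd] at hP
  have hm : (a - 3 * X * b ^ 3) * (a - 3 * (C ω * X) * b ^ 3) * (a - 3 * (C ω ^ 2 * X) * b ^ 3) =
      a ^ 3 - 27 * X ^ 3 * b ^ 9 := by
    linear_combination (-3 * a ^ 2 * X * b ^ 3 + 9 * C ω * a * X ^ 2 * b ^ 6) * hc -
      27 * X ^ 3 * b ^ 9 * hc3
  rw [hm] at hP
  linear_combination hP

end Dissection

/-! ### The derivation `θ = q d/dq`. -/

section Theta

variable (R : Type*) [CommRing R]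

/-- The derivation `q d/dq` on power series. -/
noncomputable def theta : Derivation R R⟦X⟧ R⟦X⟧ := (X : R⟦X⟧) • derivative R

variable {R}

theorem coeff_theta (f : R⟦X⟧) (n : ℕ) : coeff n (theta R f) = n * coeff n f := by
  rw [theta, Derivation.smul_apply, smul_eq_mul]
  rcases n with _ | n
  · simp
  · rw [coeff_succ_X_mul, coeff_derivative]; push_cast; ring

theorem theta_mul (f g : R⟦X⟧) : theta R (f * g) = f * theta R g + g * theta R f := by
  rw [Derivation.leibniz, smul_eq_mul, smul_eq_mul]

theorem theta_pow (f : R⟦X⟧) (n : ℕ) : theta R (f ^ n) = n * f ^ (n - 1) * theta R f := by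
  rw [Derivation.leibniz_pow, nsmul_eq_mul, smul_eq_mul, mul_assoc]

theorem theta_X : theta R X = X := by
  ext n
  rw [coeff_theta, coeff_X]
  split_ifs with h
  · simp [h]
  · simp

theorem theta_ofNat (n : ℕ) [n.AtLeastTwo] : theta R (OfNat.ofNat n : R⟦X⟧) = 0 := by
  rw [← Nat.cast_ofNat]
  exact Derivation.map_natCast _ _

theorem theta_one : theta R 1 = 0 := Derivation.map_one_eq_zero _

theorem theta_expand {p : ℕ} (hp : p ≠ 0) (f : R⟦X⟧) :
    theta R (expand p hp f) = p * expand p hp (theta R f) := by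
  ext n
  rw [coeff_theta, ← map_natCast (C (R := R)) p, coeff_C_mul, coeff_expand, coeff_expand]
  split_ifs with h
  · obtain ⟨k, rfl⟩ := h
    rcases Nat.eq_zero_or_pos p with h0 | h0
    · exact absurd h0 hp
    · rw [Nat.mul_div_cancel_left _ h0, coeff_theta]; push_cast; ring
  · simp

theorem theta_map {S : Type*} [CommRing S] (φ : R →+* S) (f : R⟦X⟧) :
    PowerSeries.map φ (theta R f) = theta S (PowerSeries.map φ f) := by
  ext n
  simp [coeff_theta]

end Theta

instance charP_powerSeries (p : ℕ) : CharP (ZMod p)⟦X⟧ p :=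
  charP_of_injective_ringHom (C_injective (R := ZMod p)) p

/-- Frobenius: clear for polynomials over `ZMod p`, and both sides respect truncation. -/
theorem expand_eq_pow (p : ℕ) [Fact p.Prime] (f : (ZMod p)⟦X⟧) :
    expand p (Fact.out : p.Prime).ne_zero f = f ^ p := by
  refine eq_of_forall_X_pow_dvd_sub fun n => ?_
  have h : ∀ g : Polynomial (ZMod p), expand p (Fact.out : p.Prime).ne_zero (g : (ZMod p)⟦X⟧) =
      (g : (ZMod p)⟦X⟧) ^ p := by
    intro g
    induction g using Polynomial.induction_on' with
    | add a b ha hb => rw [Polynomial.coe_add, map_add, ha, hb, add_pow_char]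
    | monomial n a =>
      rw [Polynomial.coe_monomial, expand_monomial, monomial_eq_C_mul_X_pow, monomial_eq_C_mul_X_pow,
        mul_pow, ← map_pow, ZMod.pow_card, ← pow_mul, mul_comm n]
  have ht : (X : (ZMod p)⟦X⟧) ^ (n + 1) ∣ f - (trunc (n + 1) f : Polynomial (ZMod p)) := by
    rw [X_pow_dvd_iff]
    intro m hm
    rw [map_sub, Polynomial.coeff_coe, coeff_trunc, if_pos hm, sub_self]
  have h1 := X_pow_dvd_expand (Fact.out : p.Prime).ne_zero ht
  have h2 := dvd_pow_sub_pow_of_dvd_sub ht p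
  rw [map_sub, h] at h1
  have := dvd_sub h1 h2
  rwa [sub_sub_sub_cancel_right] at this

/-! ### Euler products modulo `5` -/

/-- Euler's product `∏ (1 - qⁿ)` modulo `5`. -/
noncomputable abbrev y : (ZMod 5)⟦X⟧ := pentagonalSeries (ZMod 5)

/-- The product `∏ (1 - q³ⁿ)` modulo `5`. -/
noncomputable abbrev z : (ZMod 5)⟦X⟧ := expand 3 (by norm_num) y

theorem five_eq_zero : (5 : (ZMod 5)⟦X⟧) = 0 := CharP.ofNat_eq_zero _ 5

instance : Fact (Nat.Prime 5) := ⟨by norm_num⟩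

theorem y_ne_zero : y ≠ 0 := (isUnit_pentagonalSeries _).ne_zero

theorem y_mul_inv : y * y⁻¹ = 1 := PowerSeries.mul_inv_cancel _ (by simp)

/-- The weight two Eisenstein series `1 - 24 ∑ σ₁(n) qⁿ` modulo `5`. -/
noncomputable def eisP : (ZMod 5)⟦X⟧ := 1 - theta _ y * y⁻¹

/-- The weight two Eisenstein series in `q³`, modulo `5`. -/
noncomputable def eisT : (ZMod 5)⟦X⟧ := expand 3 (by norm_num) eisP

theorem theta_y : theta _ y = (1 - eisP) * y := by
  rw [eisP]
  linear_combination -theta _ y * y_mul_inv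

theorem theta_z : theta _ z = 3 * (1 - eisT) * z := by
  rw [theta_expand, theta_y, map_mul, map_sub, map_one, ← eisT]
  push_cast; ring

theorem cast_coeff_pow_three (n : ℕ) :
    coeff n (y ^ 3) = ((coeff n (pentagonalSeries ℤ ^ 3) : ℤ) : ZMod 5) := by
  rw [y, ← map_pentagonalSeries ℤ (Int.castRingHom (ZMod 5)), ← map_pow, coeff_map]; rfl

/-- The coefficients of `∏ (1 - qⁿ)³` at exponents outside `5ℤ ∪ (1 + 5ℤ)` are divisible by `5`. -/
theorem dvd_coeff_pentagonalSeries_pow_three {n : ℕ} (h : n % 5 ≠ 0) (h' : n % 5 ≠ 1) :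
    5 ∣ coeff n (pentagonalSeries ℤ ^ 3) := by
  by_cases ht : ∃ m : ℕ, 2 * n = m * (m + 1)
  · obtain ⟨m, hm⟩ := ht
    have hn : n = m * (m + 1) / 2 := by omega
    have h5 : m % 5 = 2 := by
      have h1 : m % 5 = 0 ∨ m % 5 = 1 ∨ m % 5 = 2 ∨ m % 5 = 3 ∨ m % 5 = 4 := by omega
      have h2 : 2 * n % 5 = (m % 5) * ((m + 1) % 5) % 5 := by rw [hm, Nat.mul_mod]
      rcases h1 with h1 | h1 | h1 | h1 | h1 <;> rw [Nat.add_mod, h1] at h2 <;> norm_num at h2 <;>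
        omega
    rw [hn, coeff_pentagonalSeries_pow_three_triangle]
    exact Dvd.dvd.mul_left (by omega) _
  · push Not at ht
    rw [coeff_pentagonalSeries_pow_three_eq_zero ht]
    exact dvd_zero _

theorem coeff_pentagonalSeries_pow_three_eq_zero_of_mod {n : ℕ} (h : n % 5 = 2 ∨ n % 5 = 4) :
    coeff n (pentagonalSeries ℤ ^ 3) = 0 := by
  refine coeff_pentagonalSeries_pow_three_eq_zero fun m hm => ?_
  have h1 : m % 5 = 0 ∨ m % 5 = 1 ∨ m % 5 = 2 ∨ m % 5 = 3 ∨ m % 5 = 4 := by omega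
  have h2 : 2 * n % 5 = (m % 5) * ((m + 1) % 5) % 5 := by rw [hm, Nat.mul_mod]
  rcases h1 with h1 | h1 | h1 | h1 | h1 <;> rw [Nat.add_mod, h1] at h2 <;> norm_num at h2 <;>
    omega

theorem natCast_zmod_five_eq {n r : ℕ} (h : n % 5 = r) : (n : ZMod 5) = r := by
  rw [← h, ZMod.natCast_mod]

/-- Only exponents `n ≡ 0, 1` mod `5` survive, and these satisfy `n² = n`. -/
theorem theta_theta_y_pow_three : theta _ (theta _ (y ^ 3)) = theta _ (y ^ 3) := by
  ext n
  rw [coeff_theta, coeff_theta]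
  by_cases h0 : n % 5 = 0
  · rw [natCast_zmod_five_eq h0]; simp
  by_cases h1 : n % 5 = 1
  · rw [natCast_zmod_five_eq h1]; simp
  · rw [cast_coeff_pow_three,
      (ZMod.intCast_zmod_eq_zero_iff_dvd _ 5).2 (dvd_coeff_pentagonalSeries_pow_three h0 h1)]
    simp

/-- Ramanujan's equation `θP = (P² - Q)/12` with `Q ≡ 1` mod `5`, obtained here as the Riccati form
of the equation for `y ^ 3`. -/
theorem theta_eisP : theta _ eisP = 2 * (1 - eisP ^ 2) := by
  have h := theta_theta_y_pow_three
  have h1 : theta _ (y ^ 3) = 3 * (1 - eisP) * y ^ 3 := by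
    rw [theta_pow, theta_y]; push_cast; ring
  rw [h1, theta_mul, h1, theta_mul, map_sub, theta_one, theta_ofNat] at h
  have h3 := pow_ne_zero 3 y_ne_zero
  apply mul_left_cancel₀ h3
  linear_combination 3 * h + y ^ 3 * (2 * theta _ eisP - 4 + 9 * eisP - 5 * eisP ^ 2) * five_eq_zero

theorem theta_eisT : theta _ eisT = 4 * (eisT ^ 2 - 1) := by
  rw [eisT, theta_expand, theta_eisP, map_mul, map_sub, map_pow, map_ofNat, map_one]
  push_cast
  linear_combination (2 - 2 * expand 3 (by norm_num) eisP ^ 2) * five_eq_zero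

theorem pentagonal_one_sub_five_mul (j : ℤ) : pentagonal (1 - 5 * j) = 25 * pentagonal j + 1 := by
  have h1 := two_mul_natCast_pentagonal (1 - 5 * j)
  have h2 := two_mul_natCast_pentagonal j
  have : (2 * pentagonal (1 - 5 * j) : ℤ) = 2 * (25 * pentagonal j + 1) := by
    rw [h1]; linear_combination -25 * h2
  omega

theorem pentagonal_emod_five (k : ℤ) :
    pentagonal k % 5 = 0 ∨ pentagonal k % 5 = 2 ∨ ∃ j, k = 1 - 5 * j := by
  have h1 := two_mul_natCast_pentagonal k
  have h2 : (2 * pentagonal k : ℤ) % 5 = (k % 5) * ((3 * (k % 5) - 1) % 5) % 5 := by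
    rw [h1, Int.mul_emod, Int.sub_emod, Int.mul_emod 3 k]
    simp [Int.mul_emod, Int.sub_emod]
  have h3 : k % 5 = 0 ∨ k % 5 = 1 ∨ k % 5 = 2 ∨ k % 5 = 3 ∨ k % 5 = 4 := by omega
  rcases h3 with h | h | h | h | h <;> rw [h] at h2 <;> norm_num at h2
  · left; omega
  · right; right; exact ⟨(1 - k) / 5, by omega⟩
  · left; omega
  · right; left; omega
  · right; left; omega

/-- The operator multiplies the `n`-th coefficient by `n(n - 2)`. Pentagonal numbers are `0, 1, 2`
mod `5`; only the class `1` survives, where they are `25 · pentagonal j + 1` and the signs of the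
two coefficients are opposite. -/
theorem theta_theta_y : theta _ (theta _ y) - 2 * theta _ y = X * y ^ 25 := by
  have h25 : y ^ 25 = expand (5 * 5) (by norm_num) y := by
    rw [show y ^ 25 = (y ^ 5) ^ 5 by ring, ← expand_eq_pow, ← expand_eq_pow, ← expand_mul]
  rw [h25]
  ext n
  rw [map_sub, show (2 : (ZMod 5)⟦X⟧) = C 2 from rfl, coeff_C_mul, coeff_theta, coeff_theta]
  have h2 : ((n : ZMod 5)) * (n * coeff n y) - 2 * (n * coeff n y) =
    (n : ZMod 5) * (n - 2) * coeff n y := by ring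
  rw [h2]
  by_cases hn : ∃ m, n = 25 * m + 1
  · obtain ⟨m, rfl⟩ := hn
    rw [coeff_succ_X_mul, coeff_expand_mul]
    have h3 : (((25 * m + 1 : ℕ) : ZMod 5)) = (1 : ℕ) := natCast_zmod_five_eq (by omega)
    rw [h3]
    by_cases hm : m ∈ Set.range pentagonal
    · obtain ⟨j, rfl⟩ := hm
      rw [← pentagonal_one_sub_five_mul, coeff_pentagonalSeries_pentagonal,
        coeff_pentagonalSeries_pentagonal]
      have : Int.negOnePow (1 - 5 * j) = - Int.negOnePow j := by
        rw [sub_eq_add_neg, Int.negOnePow_add, Int.negOnePow_neg, Int.negOnePow_one,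
          show 5 * j = 2 * (2 * j) + j by ring, Int.negOnePow_add, Int.negOnePow_two_mul]
        simp
      rw [this]
      push_cast
      ring
    · rw [coeff_pentagonalSeries_eq_zero _ hm, coeff_pentagonalSeries_eq_zero]
      · simp
      · rintro ⟨k, hk⟩
        rcases pentagonal_emod_five k with h | h | ⟨j, rfl⟩
        · omega
        · omega
        · rw [pentagonal_one_sub_five_mul] at hk
          exact hm ⟨j, by omega⟩
  · have hr : coeff n (X * expand (5 * 5) (by norm_num) y) = 0 := by
      rcases n with _ | n
      · simp
      · rw [coeff_succ_X_mul]
        refine coeff_expand_of_not_dvd _ _ _ fun h => hn ?_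
        obtain ⟨m, rfl⟩ := h
        exact ⟨m, by ring⟩
    rw [hr]
    by_cases hp : n ∈ Set.range pentagonal
    · obtain ⟨k, rfl⟩ := hp
      rcases pentagonal_emod_five k with h | h | ⟨j, rfl⟩
      · rw [natCast_zmod_five_eq h]; simp
      · rw [natCast_zmod_five_eq h]; simp
      · exact absurd ⟨_, pentagonal_one_sub_five_mul j⟩ hn
    · rw [coeff_pentagonalSeries_eq_zero _ hp, mul_zero]

theorem X_mul_y_pow : X * y ^ 24 = 2 * (1 - eisP ^ 2) := by
  have h := theta_theta_y
  rw [theta_y, theta_mul, map_sub, theta_one, theta_y, theta_eisP] at h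
  apply mul_left_cancel₀ y_ne_zero
  linear_combination -h - y * (1 - eisP ^ 2) * five_eq_zero

/-! ### Relations of level three modulo `5`. -/

/-- The series `jacobiThird` modulo `5`. -/
noncomputable def thirdSeries : (ZMod 5)⟦X⟧ :=
  PowerSeries.map (Int.castRingHom (ZMod 5)) jacobiThird

theorem thirdSeries_pow_three_mul :
    thirdSeries ^ 3 * z ^ 3 = y ^ 12 + 2 * X * z ^ 12 := by
  have h := congrArg (PowerSeries.map (Int.castRingHom (ZMod 5))) jacobiThird_pow_three_mul
  simp only [map_mul, map_add, map_pow, map_expand, map_pentagonalSeries, map_X, map_ofNat] at h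
  rw [thirdSeries]
  linear_combination h + 5 * X * z ^ 12 * five_eq_zero

/-- Here `3n ≡ 0, 1` mod `5` means `n ≡ 0, 2`, so that `n² = 2n`. -/
theorem theta_theta_thirdSeries :
    theta _ (theta _ thirdSeries) = 2 * theta _ thirdSeries := by
  ext n
  rw [show (2 : (ZMod 5)⟦X⟧) = C 2 from rfl, coeff_C_mul, coeff_theta, coeff_theta]
  by_cases h0 : n % 5 = 0
  · rw [natCast_zmod_five_eq h0]; simp
  by_cases h1 : n % 5 = 2
  · rw [natCast_zmod_five_eq h1]; simp
  · rw [thirdSeries, coeff_map, jacobiThird, coeff_mk, eq_intCast,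
      (ZMod.intCast_zmod_eq_zero_iff_dvd _ 5).2
        (dvd_coeff_pentagonalSeries_pow_three (by omega) (by omega))]
    simp

theorem constantCoeff_thirdSeries : constantCoeff thirdSeries = 1 := by
  rw [← coeff_zero_eq_constantCoeff_apply, thirdSeries, coeff_map, jacobiThird, coeff_mk]
  simp

theorem theta_two {R : Type*} [CommRing R] : theta R 2 = 0 := theta_ofNat 2
theorem theta_three {R : Type*} [CommRing R] : theta R 3 = 0 := theta_ofNat 3
theorem theta_four {R : Type*} [CommRing R] : theta R 4 = 0 := theta_ofNat 4

/-- The quotient `q ∏ (1 - q³ⁿ)¹² / ∏ (1 - qⁿ)¹²` modulo `5`. -/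
noncomputable def etaRatio : (ZMod 5)⟦X⟧ := X * z ^ 12 * y⁻¹ ^ 12

/-- The square of the weight one theta series of level three, modulo `5`. -/
noncomputable def eisS : (ZMod 5)⟦X⟧ := 2 * eisP - eisT

theorem etaRatio_mul : etaRatio * y ^ 12 = X * z ^ 12 := by
  have : y⁻¹ ^ 12 * y ^ 12 = 1 := by rw [← mul_pow, mul_comm, y_mul_inv, one_pow]
  rw [etaRatio]
  linear_combination X * z ^ 12 * this

theorem theta_etaRatio : theta _ etaRatio = etaRatio * eisS := by
  have h := congrArg (theta _) etaRatio_mul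
  simp only [theta_mul, theta_pow, theta_X, theta_y, theta_z] at h
  push_cast at h
  apply mul_left_cancel₀ (pow_ne_zero 12 y_ne_zero)
  rw [eisS]
  linear_combination h - (37 - 36 * eisT) * etaRatio_mul +
    y ^ 12 * etaRatio * (5 - 7 * eisT + 2 * eisP) * five_eq_zero

/-- One minus the logarithmic derivative of `thirdSeries`. -/
noncomputable def thirdLog : (ZMod 5)⟦X⟧ := 1 - theta _ thirdSeries * thirdSeries⁻¹

theorem thirdSeries_ne_zero : thirdSeries ≠ 0 := by
  intro h
  have := constantCoeff_thirdSeries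
  rw [h] at this
  simp at this

theorem theta_thirdSeries : theta _ thirdSeries = (1 - thirdLog) * thirdSeries := by
  have : thirdSeries * thirdSeries⁻¹ = 1 :=
    PowerSeries.mul_inv_cancel _ (by rw [constantCoeff_thirdSeries]; exact one_ne_zero)
  rw [thirdLog]
  linear_combination -theta _ thirdSeries * this

theorem theta_thirdLog : theta _ thirdLog = thirdLog ^ 2 - 1 := by
  have h := theta_theta_thirdSeries
  rw [theta_thirdSeries, theta_mul, map_sub, theta_one, theta_thirdSeries] at h
  apply mul_left_cancel₀ thirdSeries_ne_zero
  linear_combination -h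

/-- Logarithmic derivative of the cubic relation, read as `thirdSeries³ z³ = y¹² (1 + 2 etaRatio)`.
-/
theorem one_add_two_mul_etaRatio_mul_thirdLog :
    (1 + 2 * etaRatio) * thirdLog = 2 * eisT + 4 * eisP + 3 * etaRatio * eisT := by
  have h0 : thirdSeries ^ 3 * z ^ 3 = y ^ 12 * (1 + 2 * etaRatio) := by
    linear_combination thirdSeries_pow_three_mul - 2 * etaRatio_mul
  have h := congrArg (theta _) h0
  simp only [theta_mul, theta_pow, theta_y, theta_z, theta_thirdSeries, map_add, theta_one,
    theta_two, theta_etaRatio, eisS] at h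
  push_cast at h
  apply mul_left_cancel₀ (pow_ne_zero 12 y_ne_zero)
  linear_combination 3 * h - (36 - 27 * eisT - 9 * thirdLog) * h0 +
    y ^ 12 * (2 * (1 + 2 * etaRatio) * thirdLog + 5 * eisT - 8 * eisP - 12 * etaRatio * eisP +
      9 * etaRatio * eisT) * five_eq_zero

/-- Differentiating the previous relation and eliminating `thirdLog` by its Riccati equation leaves
`eisP` and `eisT` only in the combination `eisS`. -/
theorem etaRatio_mul_eisS_sq_add_one :
    etaRatio * (eisS ^ 2 + 1) = -2 * (eisS ^ 2 - 1) := by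
  have h0 := one_add_two_mul_etaRatio_mul_thirdLog
  have h := congrArg (theta _) h0
  simp only [theta_mul, theta_one, theta_two, theta_three, theta_four, map_add, theta_etaRatio, theta_thirdLog, theta_eisP,
    theta_eisT] at h
  rw [eisS] at h ⊢
  linear_combination 2 * (1 + 2 * etaRatio) * h - 2 * ((1 + 2 * etaRatio) * thirdLog +
    (2 * eisT + 4 * eisP + 3 * etaRatio * eisT) + 2 * etaRatio * (2 * eisP - eisT)) * h0 +
    (-3 * etaRatio - 8 * etaRatio * eisP * eisT - 12 * etaRatio * eisP ^ 2 +
      7 * etaRatio * eisT ^ 2 - 8 * etaRatio ^ 2 + 6 * etaRatio ^ 2 * eisT ^ 2 - 8 * eisP * eisT -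
      8 * eisP ^ 2 + 2 * eisT ^ 2) * five_eq_zero

theorem constantCoeff_theta {R : Type*} [CommRing R] (f : R⟦X⟧) :
    constantCoeff (theta R f) = 0 := by
  rw [← coeff_zero_eq_constantCoeff_apply, coeff_theta]; simp

theorem constantCoeff_eisS : constantCoeff eisS = 1 := by
  have hP : constantCoeff eisP = 1 := by simp [eisP, constantCoeff_theta]
  have hT : constantCoeff eisT = 1 := by rw [eisT, constantCoeff_expand, hP]
  rw [eisS, map_sub, map_mul, hP, hT, map_ofNat]
  norm_num

theorem eisS_ne_zero : eisS ≠ 0 := by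
  intro h
  have := constantCoeff_eisS
  rw [h] at this
  simp at this

theorem eisS_sq_add_one_ne_zero : eisS ^ 2 + 1 ≠ 0 := by
  intro h
  have := congrArg constantCoeff h
  rw [map_add, map_pow, constantCoeff_eisS, map_one, map_zero] at this
  exact absurd this (by decide)

theorem theta_eisS :
    theta _ eisS = 1 - eisS ^ 4 := by
  have h0 := etaRatio_mul_eisS_sq_add_one
  have h := congrArg (theta _) h0
  simp only [theta_mul, theta_one, theta_two, map_add, map_sub, map_neg, theta_etaRatio, theta_pow] at h
  push_cast at h
  apply mul_left_cancel₀ eisS_ne_zero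
  linear_combination 2 * (eisS ^ 2 + 1) * h -
    2 * (2 * eisS * theta _ eisS + eisS * (eisS ^ 2 + 1)) * h0 +
    eisS * (-3 * theta _ eisS + eisS ^ 4 - 1) * five_eq_zero

/-- Compare two values of `θ eisS`: one from the relation with `etaRatio`, one from the Riccati
equations of `eisP` and `eisT`. -/
theorem eisP_mul_eisS : eisP * eisS = 3 - eisS ^ 2 - eisS ^ 4 := by
  have h : theta _ eisS = eisP ^ 2 + eisT ^ 2 - 2 := by
    rw [eisS, map_sub, theta_mul, theta_two, theta_eisP, theta_eisT]
    linear_combination (2 - eisP ^ 2 - eisT ^ 2) * five_eq_zero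
  rw [theta_eisS] at h
  have h2 : eisT = 2 * eisP - eisS := by rw [eisS]; ring
  rw [h2] at h
  linear_combination -h + (eisP * eisS - eisP ^ 2) * five_eq_zero

/-- The left side is `etaRatio · (X y²⁴) · eisS²`, and each factor is now expressible through
`eisS`, after multiplication by `eisS² + 1`. -/
theorem sq_eq : (X * (y * z) ^ 6 * eisS) ^ 2 = (2 * (1 - eisS ^ 4)) ^ 2 := by
  have h1 := X_mul_y_pow
  have h2 := etaRatio_mul
  have h3 := etaRatio_mul_eisS_sq_add_one
  have h4 := eisP_mul_eisS
  apply mul_left_cancel₀ eisS_sq_add_one_ne_zero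
  linear_combination -eisS ^ 2 * (eisS ^ 2 + 1) * X * y ^ 12 * h2 +
    eisS ^ 2 * (eisS ^ 2 + 1) * etaRatio * h1 + 2 * eisS ^ 2 * (1 - eisP ^ 2) * h3 +
    4 * (eisS ^ 2 - 1) * (eisP * eisS + (3 - eisS ^ 2 - eisS ^ 4)) * h4 +
    (-8 + 12 * eisS ^ 2 - 4 * eisS ^ 6) * five_eq_zero

theorem coeff_one_X_mul_eq {R : Type*} [CommRing R] (f : R⟦X⟧) :
    coeff 1 (X * f) = constantCoeff f := by
  rw [← coeff_zero_eq_constantCoeff_apply]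
  exact coeff_succ_X_mul 0 f

theorem coeff_one_eisS : coeff 1 eisS = 2 := by
  have h := congrArg (coeff 1) etaRatio_mul_eisS_sq_add_one
  have h1 : etaRatio * (eisS ^ 2 + 1) = X * (z ^ 12 * y⁻¹ ^ 12 * (eisS ^ 2 + 1)) := by
    rw [etaRatio]; ring
  rw [h1, coeff_one_X_mul_eq] at h
  rw [show (-2 : (ZMod 5)⟦X⟧) = C (-2) by rw [map_neg]; rfl, coeff_C_mul, map_sub, coeff_one_pow,
    constantCoeff_eisS, coeff_one] at h
  simp [constantCoeff_eisS, constantCoeff_expand] at h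
  generalize coeff 1 eisS = c at *
  revert h
  revert c
  decide

theorem X_mul_pow_six_mul_eisS : X * (y * z) ^ 6 * eisS = 3 * (1 - eisS ^ 4) := by
  -- The coefficient of `q` decides the sign: it is `1` on the left, while `2(1 - eisS⁴)` has `-16 ≡
  -- 4`.
  rcases sq_eq_sq_iff_eq_or_eq_neg.1 sq_eq with h | h
  · exfalso
    have h1 := congrArg (coeff 1) h
    rw [mul_assoc, coeff_one_X_mul_eq] at h1
    rw [show (2 : (ZMod 5)⟦X⟧) = C 2 from rfl, coeff_C_mul, map_sub, coeff_one_pow,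
      constantCoeff_eisS, coeff_one, coeff_one_eisS] at h1
    simp [constantCoeff_eisS, constantCoeff_expand] at h1
    exact absurd h1 (by decide)
  · linear_combination h - (1 - eisS ^ 4) * five_eq_zero

/-! ### Sections modulo `5` by differentiation. -/

/-- The subsequence of coefficients with indices congruent to `r` modulo `5`. -/
noncomputable def section5 {R : Type*} [CommRing R] (r : ℕ) (f : R⟦X⟧) : R⟦X⟧ :=
  mk fun n => coeff (5 * n + r) f

@[simp] theorem coeff_section5 {R : Type*} [CommRing R] (r n : ℕ) (f : R⟦X⟧) :
    coeff n (section5 r f) = coeff (5 * n + r) f := coeff_mk _ _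

/-- The operator `q d/dq - r`. -/
noncomputable def thetaSub (r : ℕ) (f : (ZMod 5)⟦X⟧) : (ZMod 5)⟦X⟧ := theta _ f - r * f

theorem coeff_thetaSub (r n : ℕ) (f : (ZMod 5)⟦X⟧) :
    coeff n (thetaSub r f) = (n - r) * coeff n f := by
  rw [thetaSub, map_sub, coeff_theta, ← map_natCast (C (R := ZMod 5)), coeff_C_mul]
  ring

/-- By Fermat `1 - (n - r)⁴` is the indicator of `n ≡ r` mod `5`, and Frobenius turns `q ↦ q⁵` into
a fifth power. -/
theorem X_pow_mul_section5_pow {r : ℕ} (hr : r < 5) (f : (ZMod 5)⟦X⟧) :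
    X ^ r * section5 r f ^ 5 = f - thetaSub r (thetaSub r (thetaSub r (thetaSub r f))) := by
  rw [← expand_eq_pow]
  ext n
  simp only [map_sub, coeff_thetaSub, coeff_X_pow_mul']
  have hF : ∀ a : ZMod 5, a = 0 ∨ a * (a * (a * a)) = 1 := by decide
  by_cases h : n % 5 = r
  · have hn : ((n : ZMod 5) - r) = 0 := by rw [natCast_zmod_five_eq h, sub_self]
    rw [hn, if_pos (by omega), show n - r = 5 * (n / 5) by omega, coeff_expand_mul, coeff_section5,
      show 5 * (n / 5) + r = n by omega]
    ring
  · have hn : ((n : ZMod 5) - r) ≠ 0 := by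
      rw [sub_ne_zero]
      intro h'
      have := (ZMod.natCast_eq_natCast_iff' n r 5).1 h'
      omega
    have h1 := (hF _).resolve_left hn
    have h2 : (if r ≤ n then coeff (n - r) (expand 5 (Fact.out : Nat.Prime 5).ne_zero
        (section5 r f)) else 0) = 0 := by
      split_ifs with h3
      · exact coeff_expand_of_not_dvd _ _ _ (by omega)
      · rfl
    rw [h2]
    linear_combination coeff n f * h1

theorem eq_of_pow_five_eq {f g : (ZMod 5)⟦X⟧} (h : f ^ 5 = g ^ 5) : f = g := by
  have := sub_pow_char (p := 5) f g
  rw [h, sub_self] at this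
  exact sub_eq_zero.1 (pow_eq_zero_iff (by norm_num) |>.1 this)

/-- The product `∏ (1 - qⁿ)(1 - q³ⁿ)` modulo `5`. -/
noncomputable def yz : (ZMod 5)⟦X⟧ := y * z

/-- Minus the logarithmic derivative of `η(τ)η(3τ)`, modulo `5`. -/
noncomputable def eisK : (ZMod 5)⟦X⟧ := eisP + 3 * eisT

theorem theta_yz : theta _ yz = (4 - eisK) * yz := by
  rw [yz, theta_mul, theta_y, theta_z, eisK]; ring

theorem inv_mul_eisS : eisS⁻¹ * eisS = 1 :=
  PowerSeries.inv_mul_cancel _ (by rw [constantCoeff_eisS]; exact one_ne_zero)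

theorem eisK_eq : eisK = eisS⁻¹ - 2 * eisS ^ 3 := by
  have h1 := inv_mul_eisS
  have h2 := eisP_mul_eisS
  have h3 : eisT = 2 * eisP - eisS := by rw [eisS]; ring
  have h5 := five_eq_zero
  rw [eisK, h3]
  generalize eisS⁻¹ = r at *
  generalize eisS = s at *
  generalize eisP = P at *
  grind

theorem theta_inv_eisS : theta _ eisS⁻¹ = eisS ^ 2 - eisS⁻¹ ^ 2 := by
  have h1 := inv_mul_eisS
  have h := congrArg (theta _) h1
  rw [theta_mul, theta_one, theta_eisS] at h
  generalize theta _ eisS⁻¹ = d at *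
  generalize eisS⁻¹ = r at *
  generalize eisS = s at *
  grind

theorem thetaSub_yz_pow_mul (r n : ℕ) (f : (ZMod 5)⟦X⟧) :
    thetaSub r (yz ^ (n + 1) * f) =
      yz ^ (n + 1) * (theta _ f + ((n + 1) * (4 - eisK) - r) * f) := by
  rw [thetaSub, theta_mul, theta_pow, theta_yz, Nat.add_sub_cancel]
  push_cast; ring

theorem section5_three : section5 3 (yz ^ 2 * eisS ^ 2) = 2 * yz ^ 4 * eisS := by
  apply eq_of_pow_five_eq
  apply mul_left_cancel₀ (pow_ne_zero 3 X_ne_zero)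
  rw [X_pow_mul_section5_pow (by norm_num)]
  have h1 := inv_mul_eisS
  have h5 := five_eq_zero
  have hs := theta_eisS
  have hW : X * yz ^ 6 * eisS = 3 * (1 - eisS ^ 4) := X_mul_pow_six_mul_eisS
  -- The constant `2 · 4 - 3` vanishes mod `5`, leaving an operator on Laurent polynomials in
  -- `eisS`.
  have step : ∀ f, thetaSub 3 (yz ^ 2 * f) = yz ^ 2 * (theta _ f - 2 * eisK * f) := fun f => by
    rw [show 2 = 1 + 1 from rfl, thetaSub_yz_pow_mul]; push_cast
    linear_combination yz ^ 2 * f * five_eq_zero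
  have a1 : theta _ (eisS ^ 2) - 2 * eisK * eisS ^ 2 = 2 * eisS ^ 5 := by
    simp only [theta_pow, hs, eisK_eq]; push_cast
    clear * - h1 h5
    generalize eisS⁻¹ = r at h1 ⊢
    generalize eisS = s at h1 ⊢
    grind
  have a2 : theta _ (2 * eisS ^ 5) - 2 * eisK * (2 * eisS ^ 5) = eisS ^ 4 - 2 * eisS ^ 8 := by
    simp only [theta_mul, theta_two, theta_pow, hs, eisK_eq]; push_cast
    clear * - h1 h5
    generalize eisS⁻¹ = r at h1 ⊢
    generalize eisS = s at h1 ⊢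
    grind
  have a3 : theta _ (eisS ^ 4 - 2 * eisS ^ 8) - 2 * eisK * (eisS ^ 4 - 2 * eisS ^ 8) =
      2 * eisS ^ 3 + 3 * eisS ^ 7 + 3 * eisS ^ 11 := by
    simp only [theta_mul, theta_two, theta_pow, hs, eisK_eq, map_sub]; push_cast
    clear * - h1 h5
    generalize eisS⁻¹ = r at h1 ⊢
    generalize eisS = s at h1 ⊢
    grind
  have a4 : theta _ (2 * eisS ^ 3 + 3 * eisS ^ 7 + 3 * eisS ^ 11) -
      2 * eisK * (2 * eisS ^ 3 + 3 * eisS ^ 7 + 3 * eisS ^ 11) =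
      2 * eisS ^ 2 + 2 * eisS ^ 6 + 3 * eisS ^ 10 - eisS ^ 14 := by
    simp only [theta_mul, theta_two, theta_three, theta_pow, hs, eisK_eq, map_add]; push_cast
    clear * - h1 h5
    generalize eisS⁻¹ = r at h1 ⊢
    generalize eisS = s at h1 ⊢
    grind
  rw [step, a1, step, a2, step, a3, step, a4]
  have hW3 : (X * yz ^ 6 * eisS) ^ 3 = 27 * (1 - eisS ^ 4) ^ 3 := by rw [hW]; ring
  -- The fifth power of the claimed section, times `X³`, is `32 yz² eisS² (X yz⁶ eisS)³`.
  linear_combination -32 * yz ^ 2 * eisS ^ 2 * hW3 +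
    yz ^ 2 * (-173 * eisS ^ 2 + 518 * eisS ^ 6 - 519 * eisS ^ 10 + 173 * eisS ^ 14) * five_eq_zero

theorem section5_one : section5 1 (2 * yz ^ 4 * eisS) = yz ^ 2 * eisS ^ 2 := by
  apply eq_of_pow_five_eq
  apply mul_left_cancel₀ (pow_ne_zero 1 X_ne_zero)
  rw [X_pow_mul_section5_pow (by norm_num)]
  have h1 := inv_mul_eisS
  have h5 := five_eq_zero
  have hs := theta_eisS
  have hr := theta_inv_eisS
  have hW : X * yz ^ 6 * eisS = 3 * (1 - eisS ^ 4) := X_mul_pow_six_mul_eisS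
  have step : ∀ f, thetaSub 1 (yz ^ 4 * f) = yz ^ 4 * (theta _ f + eisK * f) := fun f => by
    rw [show 4 = 3 + 1 from rfl, thetaSub_yz_pow_mul]; push_cast
    linear_combination yz ^ 4 * (3 * f - eisK * f) * five_eq_zero
  have a1 : theta _ (2 * eisS) + eisK * (2 * eisS) = 4 - eisS ^ 4 := by
    simp only [theta_mul, theta_two, hs, eisK_eq]
    clear * - h1 h5
    generalize eisS⁻¹ = r at h1 ⊢
    generalize eisS = s at h1 ⊢
    grind
  have a2 : theta _ (4 - eisS ^ 4) + eisK * (4 - eisS ^ 4) =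
      4 * eisS⁻¹ + 2 * eisS ^ 3 + eisS ^ 7 := by
    simp only [map_sub, theta_pow, theta_four, hs, eisK_eq]; push_cast
    clear * - h1 h5
    generalize eisS⁻¹ = r at h1 ⊢
    generalize eisS = s at h1 ⊢
    grind
  have a3 : theta _ (4 * eisS⁻¹ + 2 * eisS ^ 3 + eisS ^ 7) +
      eisK * (4 * eisS⁻¹ + 2 * eisS ^ 3 + eisS ^ 7) =
      4 * eisS ^ 2 + 3 * eisS ^ 6 + eisS ^ 10 := by
    simp only [theta_mul, theta_two, theta_four, theta_pow, hs, hr, eisK_eq, map_add]; push_cast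
    clear * - h1 h5
    generalize eisS⁻¹ = r at h1 ⊢
    generalize eisS = s at h1 ⊢
    grind
  have a4 : theta _ (4 * eisS ^ 2 + 3 * eisS ^ 6 + eisS ^ 10) +
      eisK * (4 * eisS ^ 2 + 3 * eisS ^ 6 + eisS ^ 10) =
      2 * eisS + 2 * eisS ^ 9 - 2 * eisS ^ 13 := by
    simp only [theta_mul, theta_three, theta_four, theta_pow, hs, eisK_eq, map_add]; push_cast
    clear * - h1 h5
    generalize eisS⁻¹ = r at h1 ⊢
    generalize eisS = s at h1 ⊢
    grind
  rw [show 2 * yz ^ 4 * eisS = yz ^ 4 * (2 * eisS) by ring, step, a1, step, a2, step, a3, step, a4]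
  linear_combination -yz ^ 4 * eisS ^ 9 * hW + yz ^ 4 * (eisS ^ 13 - eisS ^ 9) * five_eq_zero

/-! ### From modulo `5` to modulo `25`. -/

theorem exists_eq_natCast_mul {m : ℕ} {f : ℤ⟦X⟧} (h : ∀ n, (m : ℤ) ∣ coeff n f) :
    ∃ g : ℤ⟦X⟧, f = m * g := by
  choose a ha using h
  refine ⟨mk a, ?_⟩
  ext n
  rw [ha, ← map_natCast (C (R := ℤ)), coeff_C_mul, coeff_mk]

theorem exists_eq_five_mul {f : ℤ⟦X⟧} (h : PowerSeries.map (Int.castRingHom (ZMod 5)) f = 0) :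
    ∃ g : ℤ⟦X⟧, f = 5 * g := by
  refine exists_eq_natCast_mul (m := 5) fun n => ?_
  have := congrArg (coeff n) h
  rw [coeff_map, map_zero] at this
  exact (ZMod.intCast_zmod_eq_zero_iff_dvd _ 5).1 this

theorem section5_mul_expand {R : Type*} [CommRing R] (r : ℕ) (hr : r < 5) (f g : R⟦X⟧) :
    section5 r (f * expand 5 (by norm_num) g) = section5 r f * g := by
  ext n
  rw [coeff_section5, coeff_mul, coeff_mul]
  symm
  refine sum_of_injOn (fun x => (5 * x.1 + r, 5 * x.2)) ?_ ?_ ?_ ?_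
  · rintro ⟨a, b⟩ _ ⟨c, d⟩ _ h
    simp only [Prod.mk.injEq] at h ⊢
    omega
  · rintro ⟨a, b⟩ h
    simp only [mem_coe, HasAntidiagonal.mem_antidiagonal] at h ⊢
    omega
  · rintro ⟨a, b⟩ h h'
    rw [HasAntidiagonal.mem_antidiagonal] at h
    dsimp only at h ⊢
    rw [coeff_expand_of_not_dvd, mul_zero]
    rintro ⟨k, rfl⟩
    apply h'
    refine ⟨(n - k, k), ?_, ?_⟩
    · simp only [mem_coe, HasAntidiagonal.mem_antidiagonal]; omega
    · simp only [Prod.mk.injEq, and_true]; omega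
  · rintro ⟨a, b⟩ _
    rw [coeff_section5, coeff_expand_mul]

theorem section5_add {R : Type*} [CommRing R] (r : ℕ) (f g : R⟦X⟧) :
    section5 r (f + g) = section5 r f + section5 r g := by
  ext n; simp

theorem section5_natCast_mul {R : Type*} [CommRing R] (r m : ℕ) (f : R⟦X⟧) :
    section5 r ((m : R⟦X⟧) * f) = m * section5 r f := by
  ext n
  rw [coeff_section5, ← map_natCast (C (R := R)), coeff_C_mul, coeff_C_mul, coeff_section5]

theorem map_section5 {R S : Type*} [CommRing R] [CommRing S] (φ : R →+* S) (r : ℕ) (f : R⟦X⟧) :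
    PowerSeries.map φ (section5 r f) = section5 r (PowerSeries.map φ f) := by
  ext n; simp

/-- Euler's product satisfies `E(q)⁵ = E(q⁵) - 5 v` with `v` of known logarithmic derivative
modulo `5`. -/
theorem exists_pentagonalSeries_pow_five :
    ∃ v : ℤ⟦X⟧, pentagonalSeries ℤ ^ 5 = expand 5 (by norm_num) (pentagonalSeries ℤ) - 5 * v ∧
      theta _ (PowerSeries.map (Int.castRingHom (ZMod 5)) v) = (eisP - eisP ^ 5) * y ^ 5 := by
  obtain ⟨v, hv⟩ : ∃ v : ℤ⟦X⟧,
      expand 5 (by norm_num) (pentagonalSeries ℤ) - pentagonalSeries ℤ ^ 5 = 5 * v := by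
    apply exists_eq_five_mul
    rw [map_sub, map_expand, map_pow, map_pentagonalSeries, expand_eq_pow, sub_self]
  refine ⟨v, by linear_combination -hv, ?_⟩
  -- Differentiation is done over `ℤ`: both terms on the left gain a factor `5`, which can be
  -- cancelled before reducing.
  have h := congrArg (theta ℤ) hv
  rw [map_sub, theta_expand, theta_pow, theta_mul, theta_ofNat] at h
  have h5 : (5 : ℤ⟦X⟧) ≠ 0 := by
    intro h0
    have := congrArg constantCoeff h0
    rw [map_ofNat, map_zero] at this
    norm_num at this
  have h' : theta ℤ v = expand 5 (by norm_num) (theta ℤ (pentagonalSeries ℤ)) -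
      pentagonalSeries ℤ ^ 4 * theta ℤ (pentagonalSeries ℤ) := by
    apply mul_left_cancel₀ h5
    push_cast at h
    linear_combination -h
  rw [← theta_map, h', map_sub, map_expand, map_mul, map_pow, theta_map, map_pentagonalSeries,
    expand_eq_pow, theta_y, mul_pow, sub_pow_char (p := 5)]
  ring

theorem section5_two {v : (ZMod 5)⟦X⟧} (hv : theta _ v = (eisP - eisP ^ 5) * y ^ 5) :
    section5 2 (yz ^ 3 * (v * z ^ 5 + expand 3 (by norm_num) v * y ^ 5)) = yz ^ 4 * eisS ^ 2 := by
  have hv3 : theta _ (expand 3 (by norm_num) v) = 3 * (eisT - eisT ^ 5) * z ^ 5 := by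
    rw [theta_expand, hv, eisT]
    simp only [map_mul, map_sub, map_pow]
    push_cast; ring
  have h5 := five_eq_zero
  have hc5 : ∀ f : (ZMod 5)⟦X⟧, theta _ (f ^ 5) = 0 := fun f => by
    rw [theta_pow]; push_cast; rw [five_eq_zero]; ring
  have hK5 : eisK ^ 5 = eisP ^ 5 + 3 * eisT ^ 5 := by
    rw [eisK, add_pow_char (p := 5)]
    linear_combination 48 * eisT ^ 5 * five_eq_zero
  have hK5' : eisK ^ 5 = eisS⁻¹ ^ 5 - 2 * eisS ^ 15 := by
    rw [eisK_eq, sub_pow_char (p := 5)]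
    linear_combination -6 * eisS ^ 15 * five_eq_zero
  generalize hw : v * z ^ 5 + expand 3 (by norm_num) v * y ^ 5 = w
  -- This is `yz⁵ (eisK - eisK⁵)`, by Frobenius. The series `w` itself is not expressed through
  -- `eisS`, so its coefficient `A` and the remainder `B` are tracked separately; `A` returns to `1`
  -- after four steps and `w` cancels.
  have hθw : theta _ w = yz ^ 5 * (eisS⁻¹ + 3 * eisS ^ 3 + 4 * eisS⁻¹ ^ 5 + 2 * eisS ^ 15) := by
    rw [← hw, map_add, theta_mul, theta_mul, hc5, hc5, hv, hv3, yz]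
    have h1 : eisP + 3 * eisT = eisS⁻¹ - 2 * eisS ^ 3 := eisK_eq
    have h2 := hK5.symm.trans hK5'
    linear_combination (y * z) ^ 5 * h1 - (y * z) ^ 5 * h2 +
      (y * z) ^ 5 * (-eisS ^ 3 - eisS⁻¹ ^ 5) * five_eq_zero
  clear hw hv hv3 hK5 hK5'
  apply eq_of_pow_five_eq
  apply mul_left_cancel₀ (pow_ne_zero 2 X_ne_zero)
  rw [X_pow_mul_section5_pow (by norm_num)]
  have h1 := inv_mul_eisS
  have hs := theta_eisS
  have hr := theta_inv_eisS
  have hW : X * yz ^ 6 * eisS = 3 * (1 - eisS ^ 4) := X_mul_pow_six_mul_eisS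
  have step : ∀ A B, thetaSub 2 (yz ^ 3 * (A * w + yz ^ 5 * B)) =
      yz ^ 3 * ((theta _ A + 2 * eisK * A) * w + yz ^ 5 * (theta _ B + 2 * eisK * B +
        A * (eisS⁻¹ + 3 * eisS ^ 3 + 4 * eisS⁻¹ ^ 5 + 2 * eisS ^ 15))) := fun A B => by
    rw [show yz ^ 3 = yz ^ (2 + 1) from rfl, thetaSub_yz_pow_mul, map_add, theta_mul, theta_mul,
      hc5, hθw]
    push_cast
    linear_combination yz ^ 3 * (A * w + yz ^ 5 * B) * (2 - eisK) * five_eq_zero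
  have a1 : theta _ 1 + 2 * eisK * 1 = 2 * eisS⁻¹ + eisS ^ 3 := by
    simp only [theta_one, eisK_eq]
    clear * - h1 h5
    generalize eisS⁻¹ = r at h1 ⊢
    generalize eisS = s at h1 ⊢
    grind
  have b1 : theta _ 0 + 2 * eisK * 0 + 1 * (eisS⁻¹ + 3 * eisS ^ 3 + 4 * eisS⁻¹ ^ 5 + 2 * eisS ^ 15) =
      eisS⁻¹ + 3 * eisS ^ 3 + 4 * eisS⁻¹ ^ 5 + 2 * eisS ^ 15 := by
    rw [map_zero]; ring
  have a2 : theta _ (2 * eisS⁻¹ + eisS ^ 3) + 2 * eisK * (2 * eisS⁻¹ + eisS ^ 3) =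
      2 * eisS⁻¹ ^ 2 + 4 * eisS ^ 2 + 3 * eisS ^ 6 := by
    simp only [map_add, theta_mul, theta_two, theta_pow, hs, hr, eisK_eq]; push_cast
    clear * - h1 h5
    generalize eisS⁻¹ = r at h1 ⊢
    generalize eisS = s at h1 ⊢
    grind
  have b2 : theta _ (eisS⁻¹ + 3 * eisS ^ 3 + 4 * eisS⁻¹ ^ 5 + 2 * eisS ^ 15) +
      2 * eisK * (eisS⁻¹ + 3 * eisS ^ 3 + 4 * eisS⁻¹ ^ 5 + 2 * eisS ^ 15) +
      (2 * eisS⁻¹ + eisS ^ 3) * (eisS⁻¹ + 3 * eisS ^ 3 + 4 * eisS⁻¹ ^ 5 + 2 * eisS ^ 15) =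
      2 * eisS ^ 6 + 4 * eisS ^ 2 + eisS⁻¹ ^ 6 + 3 * eisS ^ 14 + 4 * eisS ^ 18 + eisS⁻¹ ^ 2 := by
    simp only [map_add, theta_mul, theta_two, theta_three, theta_four, theta_pow, hs, hr, eisK_eq]
    push_cast
    clear * - h1 h5
    generalize eisS⁻¹ = r at h1 ⊢
    generalize eisS = s at h1 ⊢
    grind
  have a3 : theta _ (2 * eisS⁻¹ ^ 2 + 4 * eisS ^ 2 + 3 * eisS ^ 6) +
      2 * eisK * (2 * eisS⁻¹ ^ 2 + 4 * eisS ^ 2 + 3 * eisS ^ 6) = 2 * eisS := by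
    simp only [map_add, theta_mul, theta_two, theta_three, theta_four, theta_pow, hs, hr, eisK_eq]
    push_cast
    clear * - h1 h5
    generalize eisS⁻¹ = r at h1 ⊢
    generalize eisS = s at h1 ⊢
    grind
  have b3 : theta _ (2 * eisS ^ 6 + 4 * eisS ^ 2 + eisS⁻¹ ^ 6 + 3 * eisS ^ 14 + 4 * eisS ^ 18 +
        eisS⁻¹ ^ 2) +
      2 * eisK * (2 * eisS ^ 6 + 4 * eisS ^ 2 + eisS⁻¹ ^ 6 + 3 * eisS ^ 14 + 4 * eisS ^ 18 +
        eisS⁻¹ ^ 2) +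
      (2 * eisS⁻¹ ^ 2 + 4 * eisS ^ 2 + 3 * eisS ^ 6) *
        (eisS⁻¹ + 3 * eisS ^ 3 + 4 * eisS⁻¹ ^ 5 + 2 * eisS ^ 15) =
      2 * eisS ^ 5 + 4 * eisS⁻¹ ^ 7 + 2 * eisS ^ 13 + 3 * eisS ^ 21 + eisS + 4 * eisS ^ 17 +
        4 * eisS ^ 9 := by
    simp only [map_add, theta_mul, theta_two, theta_three, theta_four, theta_pow, hs, hr, eisK_eq]
    push_cast
    clear * - h1 h5
    generalize eisS⁻¹ = r at h1 ⊢
    generalize eisS = s at h1 ⊢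
    grind
  have a4 : theta _ (2 * eisS) + 2 * eisK * (2 * eisS) = 1 := by
    simp only [theta_mul, theta_two, hs, eisK_eq]
    clear * - h1 h5
    generalize eisS⁻¹ = r at h1 ⊢
    generalize eisS = s at h1 ⊢
    grind
  have b4 : theta _ (2 * eisS ^ 5 + 4 * eisS⁻¹ ^ 7 + 2 * eisS ^ 13 + 3 * eisS ^ 21 + eisS +
        4 * eisS ^ 17 + 4 * eisS ^ 9) +
      2 * eisK * (2 * eisS ^ 5 + 4 * eisS⁻¹ ^ 7 + 2 * eisS ^ 13 + 3 * eisS ^ 21 + eisS +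
        4 * eisS ^ 17 + 4 * eisS ^ 9) +
      2 * eisS * (eisS⁻¹ + 3 * eisS ^ 3 + 4 * eisS⁻¹ ^ 5 + 2 * eisS ^ 15) =
      eisS ^ 16 + eisS ^ 8 + 3 * eisS ^ 12 := by
    simp only [map_add, theta_mul, theta_two, theta_three, theta_four, theta_pow, hs, hr, eisK_eq]
    push_cast
    clear * - h1 h5
    generalize eisS⁻¹ = r at h1 ⊢
    generalize eisS = s at h1 ⊢
    grind
  conv_lhs =>
    rw [show yz ^ 3 * w = yz ^ 3 * (1 * w + yz ^ 5 * 0) by ring]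
    rw [step, a1, b1, step, a2, b2, step, a3, b3, step, a4, b4]
  have hW2 : (X * yz ^ 6 * eisS) ^ 2 = 9 * (1 - eisS ^ 4) ^ 2 := by rw [hW]; ring
  linear_combination -yz ^ 8 * eisS ^ 8 * hW2 +
    yz ^ 8 * (-2 * eisS ^ 8 + 3 * eisS ^ 12 - 2 * eisS ^ 16) * five_eq_zero

/-- In the progression `2` mod `5`, the coefficients of the cube of `∏ (1 - qⁿ)(1 - q³ⁿ)` are
divisible by `25`. -/
theorem dvd_coeff_cube (n : ℕ) :
    (25 : ℤ) ∣ coeff (5 * n + 2)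
      (pentagonalSeries ℤ ^ 3 * expand 3 (by norm_num) (pentagonalSeries ℤ ^ 3)) := by
  rw [coeff_mul]
  refine dvd_sum ?_
  rintro ⟨i, j⟩ hij
  rw [HasAntidiagonal.mem_antidiagonal] at hij
  dsimp only at hij ⊢
  by_cases hj : 3 ∣ j
  · obtain ⟨k, rfl⟩ := hj
    rw [coeff_expand_mul]
    by_cases hi : i % 5 = 2 ∨ i % 5 = 4
    · rw [coeff_pentagonalSeries_pow_three_eq_zero_of_mod hi]; simp
    by_cases hk : k % 5 = 2 ∨ k % 5 = 4
    · rw [coeff_pentagonalSeries_pow_three_eq_zero_of_mod hk]; simp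
    -- With both residues in `{0, 1, 3}`, `i + 3k ≡ 2` forces both to be `3`, and each cube
    -- contributes a factor `5`.
    have h1 : i % 5 = 3 ∧ k % 5 = 3 := by
      have hi' : i % 5 = 0 ∨ i % 5 = 1 ∨ i % 5 = 3 := by omega
      have hk' : k % 5 = 0 ∨ k % 5 = 1 ∨ k % 5 = 3 := by omega
      have hs : (i % 5 + 3 * (k % 5)) % 5 = 2 := by omega
      rcases hi' with h | h | h <;> rcases hk' with h' | h' | h' <;> rw [h, h'] at hs <;> omega
    rw [show (25 : ℤ) = 5 * 5 by norm_num]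
    exact mul_dvd_mul (dvd_coeff_pentagonalSeries_pow_three (by omega) (by omega))
      (dvd_coeff_pentagonalSeries_pow_three (by omega) (by omega))
  · rw [coeff_expand_of_not_dvd _ _ _ hj, mul_zero]
    exact dvd_zero _

/-- Multiplying `p` by the squares of the Euler products in `q⁵` and `q¹⁵` commutes with taking
sections. Expanding `E(q⁵) = E⁵ + 5v` replaces the exponent `-2` by `3` up to a correction `5(…)`
mod `25`. The leading term dies by `dvd_coeff_cube`; `section5_two` evaluates the correction. -/
theorem exists_section5_two_eq {p : ℤ⟦X⟧}
    (hp : p * (pentagonalSeries ℤ * expand 3 (by norm_num) (pentagonalSeries ℤ)) ^ 2 = 1) :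
    ∃ g : ℤ⟦X⟧, section5 2 p = 5 * g ∧
      PowerSeries.map (Int.castRingHom (ZMod 5)) g = yz ^ 2 * eisS ^ 2 := by
  obtain ⟨v, hv, hθ⟩ := exists_pentagonalSeries_pow_five
  set E := pentagonalSeries ℤ with hE
  set E3 := expand 3 (by norm_num) E with hE3
  set v3 := expand 3 (by norm_num) v with hv3
  set E5 := expand 5 (by norm_num) E with hE5
  set E15 := expand 5 (by norm_num) E3 with hE15
  have hv' : E3 ^ 5 = E15 - 5 * v3 := by
    have := congrArg (expand 3 (by norm_num : 3 ≠ 0)) hv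
    rw [map_pow, map_sub, map_mul, map_ofNat] at this
    rw [hE3, this, hE15, hE5, hE3, hv3, ← expand_mul, ← expand_mul]
  obtain ⟨F', hF'⟩ := exists_eq_natCast_mul (m := 25) (f := section5 2 (E ^ 3 * E3 ^ 3)) (by
    intro n
    rw [coeff_section5, hE3, ← map_pow]
    exact dvd_coeff_cube n)
  push_cast at hF'
  have key : p * expand 5 (by norm_num) ((E * E3) ^ 2) =
      E ^ 3 * E3 ^ 3 * expand 5 (by norm_num) (E * E3) +
        (((5 : ℕ) : ℤ⟦X⟧) * (E ^ 3 * E3 ^ 3 * (v * E15 + v3 * E5)) +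
        ((25 : ℕ) : ℤ⟦X⟧) * (E ^ 3 * E3 ^ 3 * v * v3 + p * (v ^ 2 * E15 ^ 2 + v3 ^ 2 * E5 ^ 2 -
          25 * v ^ 2 * v3 ^ 2))) := by
    rw [map_pow, map_mul, ← hE5, ← hE15]
    push_cast
    have e1 : E5 = E ^ 5 + 5 * v := by rw [hv]; ring
    have e2 : E15 = E3 ^ 5 + 5 * v3 := by rw [hv']; ring
    rw [e1, e2]
    linear_combination (E ^ 3 * E3 ^ 3) * (E ^ 5 + 10 * v) * (E3 ^ 5 + 10 * v3) * hp
  have key2 := congrArg (section5 2) key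
  rw [section5_mul_expand _ (by norm_num), section5_add, section5_add, section5_mul_expand _ (by norm_num),
    section5_natCast_mul, section5_natCast_mul, hF'] at key2
  generalize section5 2 (E ^ 3 * E3 ^ 3 * v * v3 + p * (v ^ 2 * E15 ^ 2 + v3 ^ 2 * E5 ^ 2 -
          25 * v ^ 2 * v3 ^ 2)) = Q at key2
  push_cast at key2
  refine ⟨section5 2 (E ^ 3 * E3 ^ 3 * (v * E15 + v3 * E5)) * p + 5 * (F' * (E * E3) + Q) * p, ?_, ?_⟩
  · linear_combination p * key2 - section5 2 p * hp
  · have h5 := five_eq_zero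
    have hs := section5_two hθ
    simp only [map_add, map_mul, map_ofNat, h5, zero_mul, add_zero, map_section5, map_pow]
    simp only [hE3, hE5, hE15, hv3, map_expand, hE, map_pentagonalSeries]
    have hz : expand 5 (by norm_num) (expand 3 (by norm_num) (pentagonalSeries (ZMod 5))) = z ^ 5 :=
      expand_eq_pow 5 _
    have hy : expand 5 (by norm_num) (pentagonalSeries (ZMod 5)) = y ^ 5 := expand_eq_pow 5 _
    rw [hz, hy, ← mul_pow, ← yz, hs]
    have hp5 := congrArg (PowerSeries.map (Int.castRingHom (ZMod 5))) hp
    simp only [map_mul, map_pow, hE3, map_expand, hE, map_pentagonalSeries, map_one] at hp5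
    rw [← yz] at hp5
    linear_combination yz ^ 2 * eisS ^ 2 * hp5

/-! ### The generating function of coloured partitions. -/

/-- The multisets of elements of `S` whose first components add up to `n`. -/
def partsIn (S : Finset (ℕ × ℕ)) (n : ℕ) : Set (Multiset (ℕ × ℕ)) :=
  {s | (∀ x ∈ s, x ∈ S) ∧ (s.map Prod.fst).sum = n}

theorem finite_partsIn {S : Finset (ℕ × ℕ)} (hS : ∀ x ∈ S, 0 < x.1) (n : ℕ) :
    (partsIn S n).Finite := by
  refine (Finset.finite_toSet (Multiset.powerset (n • S.val)).toFinset).subset ?_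
  rintro s ⟨h1, h2⟩
  rw [mem_coe, Multiset.mem_toFinset, Multiset.mem_powerset, Multiset.le_iff_count]
  intro x
  by_cases hx : x ∈ s
  · have hcard : s.card ≤ n := by
      have h := Multiset.card_nsmul_le_sum (s := s.map Prod.fst) (a := 1) (by
        intro y hy
        obtain ⟨z, hz, rfl⟩ := Multiset.mem_map.1 hy
        exact hS z (h1 z hz))
      rw [h2, Multiset.card_map] at h
      simpa using h
    rw [Multiset.count_nsmul, Multiset.count_eq_one_of_mem S.nodup (h1 x hx), mul_one]
    exact (Multiset.count_le_card x s).trans hcard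
  · simp [Multiset.count_eq_zero_of_notMem hx]

theorem partsIn_insert (S : Finset (ℕ × ℕ)) (a : ℕ × ℕ) (n : ℕ) :
    partsIn (insert a S) n = {s ∈ partsIn (insert a S) n | a ∉ s} ∪
      {s ∈ partsIn (insert a S) n | a ∈ s} := by
  ext s
  by_cases h : a ∈ s <;> simp [h]

/-- A multiset either avoids `a` or comes from a smaller one by adding a copy of `a`; on series this
is multiplication by `1 - X ^ a.1`. -/
theorem ncard_partsIn_insert {S : Finset (ℕ × ℕ)} {a : ℕ × ℕ} (ha : a ∉ S)
    (hS : ∀ x ∈ insert a S, 0 < x.1) (n : ℕ) :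
    (partsIn (insert a S) n).ncard =
      (partsIn S n).ncard + if a.1 ≤ n then (partsIn (insert a S) (n - a.1)).ncard else 0 := by
  have hfin := finite_partsIn hS n
  rw [partsIn_insert, Set.ncard_union_eq _ (hfin.subset (Set.sep_subset _ _))
    (hfin.subset (Set.sep_subset _ _))]
  · congr 1
    · congr 1
      ext s
      simp only [partsIn, Set.mem_ofPred_eq, mem_insert]
      constructor
      · rintro ⟨⟨h1, h2⟩, h3⟩
        exact ⟨fun x hx => (h1 x hx).resolve_left fun h => h3 (h ▸ hx), h2⟩
      · rintro ⟨h1, h2⟩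
        exact ⟨⟨fun x hx => Or.inr (h1 x hx), h2⟩, fun h => ha (h1 a h)⟩
    · split_ifs with h
      · have hinj : Function.Injective fun s : Multiset (ℕ × ℕ) => a ::ₘ s :=
          fun s t h => (Multiset.cons_inj_right a).1 h
        rw [← Set.ncard_image_of_injective (partsIn (insert a S) (n - a.1)) hinj]
        congr 1
        ext s
        simp only [partsIn, Set.mem_ofPred_eq, Set.mem_image]
        constructor
        · rintro ⟨⟨h1, h2⟩, h3⟩
          obtain ⟨t, rfl⟩ := Multiset.exists_cons_of_mem h3
          refine ⟨t, ⟨fun x hx => h1 x (Multiset.mem_cons_of_mem hx), ?_⟩, rfl⟩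
          rw [Multiset.map_cons, Multiset.sum_cons] at h2
          omega
        · rintro ⟨t, ⟨h1, h2⟩, rfl⟩
          refine ⟨⟨fun x hx => ?_, ?_⟩, Multiset.mem_cons_self _ _⟩
          · rcases Multiset.mem_cons.1 hx with rfl | hx
            · exact mem_insert_self _ _
            · exact h1 x hx
          · rw [Multiset.map_cons, Multiset.sum_cons]; omega
      · rw [Set.ncard_eq_zero (hfin.subset (Set.sep_subset _ _)), Set.eq_empty_iff_forall_notMem]
        rintro s ⟨⟨h1, h2⟩, h3⟩
        have := Multiset.le_sum_of_mem (Multiset.mem_map_of_mem Prod.fst h3)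
        omega
  · rw [Set.disjoint_left]
    rintro s ⟨_, h1⟩ ⟨_, h2⟩
    exact h1 h2

theorem mk_ncard_partsIn_mul_prod (S : Finset (ℕ × ℕ)) (hS : ∀ x ∈ S, 0 < x.1) :
    (mk fun n => ((partsIn S n).ncard : ℤ)) * ∏ x ∈ S, (1 - X ^ x.1 : ℤ⟦X⟧) = 1 := by
  induction S using Finset.induction_on with
  | empty =>
    rw [prod_empty, mul_one]
    ext n
    rw [coeff_mk, coeff_one]
    split_ifs with h
    · have : partsIn ∅ n = {0} := by
        ext s
        simp only [partsIn, notMem_empty, Set.mem_ofPred_eq, Set.mem_singleton_iff]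
        constructor
        · rintro ⟨h1, _⟩
          exact Multiset.eq_zero_of_forall_notMem h1
        · rintro rfl
          simp [h]
      rw [this, Set.ncard_singleton]; rfl
    · have : partsIn ∅ n = ∅ := by
        rw [Set.eq_empty_iff_forall_notMem]
        rintro s ⟨h1, h2⟩
        have := Multiset.eq_zero_of_forall_notMem (s := s) (fun x hx => by simpa using h1 x hx)
        subst this
        exact h (by simpa using h2.symm)
      rw [this, Set.ncard_empty]; rfl
  | insert a S ha ih =>
    rw [prod_insert ha, ← mul_assoc]
    have : (PowerSeries.mk fun n => ((partsIn (insert a S) n).ncard : ℤ)) * (1 - X ^ a.1) =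
        PowerSeries.mk fun n => ((partsIn S n).ncard : ℤ) := by
      ext n
      rw [mul_sub, mul_one, map_sub, coeff_mul_X_pow', coeff_mk, coeff_mk, coeff_mk,
        ncard_partsIn_insert ha hS]
      push_cast
      split_ifs <;> ring
    rw [this]
    exact ih fun x hx => hS x (mem_insert_of_mem hx)

/-- The coloured parts of size at most `N`. -/
def colouredParts (k r N : ℕ) : Finset (ℕ × ℕ) :=
  ((range N).image Nat.succ ×ˢ range (2 * k)).filter fun x => x.2 < numColors k r x.1

theorem mem_colouredParts {k r N : ℕ} {x : ℕ × ℕ} :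
    x ∈ colouredParts k r N ↔ x.1 ∈ (range N).image Nat.succ ∧ x.2 ∈ range (numColors k r x.1) := by
  have : numColors k r x.1 ≤ 2 * k := by unfold numColors; split_ifs <;> omega
  rw [colouredParts, mem_filter, mem_product, mem_range, mem_range, and_assoc]
  constructor
  · rintro ⟨h1, _, h2⟩
    exact ⟨h1, h2⟩
  · rintro ⟨h1, h2⟩
    exact ⟨h1, by omega, h2⟩

theorem pos_of_mem_colouredParts {k r N : ℕ} {x : ℕ × ℕ} (h : x ∈ colouredParts k r N) :
    0 < x.1 := by
  obtain ⟨i, _, hi⟩ := mem_image.1 (mem_colouredParts.1 h).1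
  omega

theorem coloredPartitionCount_eq_ncard (k r : ℕ) {n N : ℕ} (h : n ≤ N) :
    coloredPartitionCount k r n = (partsIn (colouredParts k r N) n).ncard := by
  rw [coloredPartitionCount, ← Nat.card_coe_set_eq]
  refine Nat.card_congr ⟨fun p => ⟨p.parts, fun x hx => ?_, p.parts_sum⟩,
    fun s => ⟨s.1, fun x hx => pos_of_mem_colouredParts (s.2.1 x hx),
      fun x hx => mem_range.1 (mem_colouredParts.1 (s.2.1 x hx)).2, s.2.2⟩, fun _ => rfl, fun _ => rfl⟩
  rw [mem_colouredParts]
  refine ⟨mem_image.2 ⟨x.1 - 1, mem_range.2 ?_, ?_⟩, mem_range.2 (p.color_lt x hx)⟩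
  · have h1 := Multiset.le_sum_of_mem (Multiset.mem_map_of_mem Prod.fst hx)
    rw [p.parts_sum] at h1
    have := p.parts_pos x hx
    omega
  · have := p.parts_pos x hx
    omega

theorem prod_colouredParts (M : ℕ) :
    ∏ x ∈ colouredParts 2 3 (3 * M), (1 - X ^ x.1 : ℤ⟦X⟧) =
      (qProd ℤ (3 * M) * expand 3 (by norm_num) (qProd ℤ M)) ^ 2 := by
  rw [prod_finset_product _ ((range (3 * M)).image Nat.succ) (fun m => range (numColors 2 3 m))
    (fun p => mem_colouredParts), prod_image (Nat.succ_injective.injOn)]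
  simp only [prod_const, card_range]
  induction M with
  | zero => simp [qProd]
  | succ M ih =>
    have hs : ∀ k, qProd ℤ (k + 1) = qProd ℤ k * (1 - X ^ (k + 1)) := fun k => prod_range_succ _ _
    rw [show 3 * (M + 1) = 3 * M + 1 + 1 + 1 by ring, prod_range_succ, prod_range_succ,
      prod_range_succ, ih, hs (3 * M + 1 + 1), hs (3 * M + 1), hs (3 * M), hs M]
    have c1 : numColors 2 3 (3 * M).succ = 2 := by unfold numColors; rw [if_neg (by omega)]
    have c2 : numColors 2 3 (3 * M + 1).succ = 2 := by unfold numColors; rw [if_neg (by omega)]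
    have c3 : numColors 2 3 (3 * M + 1 + 1).succ = 4 := by unfold numColors; rw [if_pos (by omega)]
    rw [c1, c2, c3]
    simp only [map_mul, map_sub, map_one, map_pow, expand_X, Nat.succ_eq_add_one]
    rw [← pow_mul, show 3 * (M + 1) = 3 * M + 1 + 1 + 1 by ring]
    ring

/-- The generating function of the coloured partitions. -/
theorem mk_coloredPartitionCount_mul :
    (mk fun n => (coloredPartitionCount 2 3 n : ℤ)) *
      (pentagonalSeries ℤ * expand 3 (by norm_num) (pentagonalSeries ℤ)) ^ 2 = 1 := by
  refine eq_of_forall_X_pow_dvd_sub fun n => ?_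
  have h := mk_ncard_partsIn_mul_prod (colouredParts 2 3 (3 * n))
    fun x hx => pos_of_mem_colouredParts hx
  rw [prod_colouredParts] at h
  have h1 : (X : ℤ⟦X⟧) ^ (n + 1) ∣
      (PowerSeries.mk fun m => ((partsIn (colouredParts 2 3 (3 * n)) m).ncard : ℤ)) -
        PowerSeries.mk fun n => (coloredPartitionCount 2 3 n : ℤ) := by
    rw [X_pow_dvd_iff]
    intro m hm
    rw [map_sub, coeff_mk, coeff_mk, coloredPartitionCount_eq_ncard 2 3 (show m ≤ 3 * n by omega),
      sub_self]
  have h2 := X_pow_dvd_expand (p := 3) (by norm_num) (X_pow_dvd_qProd_sub ℤ n)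
  rw [map_sub] at h2
  have h3 := dvd_mul_sub_mul_of_dvd_sub h1 (dvd_pow_sub_pow_of_dvd_sub
    (dvd_mul_sub_mul_of_dvd_sub (X_pow_dvd_qProd_sub_of_le ℤ (show n ≤ 3 * n by omega)) h2) 2)
  rw [h] at h3
  exact (dvd_sub_comm).1 h3

end PartitionCongruence

/-! ### The congruences. -/

open PartitionCongruence PowerSeries

theorem corollary3 :
    (∀ n : ℕ, coloredPartitionCount 2 3 (5 * n + 2) ≡ 0 [MOD 5]) ∧
    (∀ n k : ℕ, 0 < k →
      coloredPartitionCount 2 3 (5 ^ (2 * k) * n + (2 * 5 ^ (2 * k) + 1) / 3) ≡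
        coloredPartitionCount 2 3 (25 * n + 17) [MOD 5 ^ 2]) := by
  obtain ⟨g, hg, hg5⟩ := exists_section5_two_eq mk_coloredPartitionCount_mul
  have hc : ∀ n, (coloredPartitionCount 2 3 (5 * n + 2) : ℤ) = 5 * coeff n g := by
    intro n
    have := congrArg (coeff n) hg
    rwa [coeff_section5, coeff_mk, show (5 : ℤ⟦X⟧) = C 5 from rfl, coeff_C_mul] at this
  have hcoeff : ∀ n, ((coeff n g : ℤ) : ZMod 5) = coeff n (yz ^ 2 * eisS ^ 2) := by
    intro n
    rw [← hg5, coeff_map]; rfl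
  have hrec : ∀ m, ((coeff (5 * (25 * m + 16) + 3) g : ℤ) : ZMod 5) =
      ((coeff (5 * m + 3) g : ℤ) : ZMod 5) := by
    intro m
    rw [hcoeff, hcoeff, ← coeff_section5, section5_three, show 25 * m + 16 = 5 * (5 * m + 3) + 1 by
      ring, ← coeff_section5, section5_one]
  have hstep : ∀ m, coloredPartitionCount 2 3 (25 * (25 * m + 16) + 17) ≡
      coloredPartitionCount 2 3 (25 * m + 17) [MOD 5 ^ 2] := by
    intro m
    rw [← Int.natCast_modEq_iff, show 25 * (25 * m + 16) + 17 = 5 * (5 * (25 * m + 16) + 3) + 2 by ring,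
      show 25 * m + 17 = 5 * (5 * m + 3) + 2 by ring, hc, hc]
    have := (ZMod.intCast_eq_intCast_iff _ _ 5).1 (hrec m)
    have h2 := this.mul_left' (c := 5)
    exact_mod_cast h2
  refine ⟨fun n => ?_, fun n k hk => ?_⟩
  · rw [Nat.modEq_zero_iff_dvd]
    exact_mod_cast (Dvd.intro _ (hc n).symm : (5 : ℤ) ∣ _)
  · have hidx : ∀ k : ℕ, ∃ m, 5 ^ (2 * (k + 1)) * n + (2 * 5 ^ (2 * (k + 1)) + 1) / 3 = 25 * m + 17 ∧
        coloredPartitionCount 2 3 (25 * m + 17) ≡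
          coloredPartitionCount 2 3 (25 * n + 17) [MOD 5 ^ 2] := by
      intro k
      induction k with
      | zero => exact ⟨n, by norm_num, rfl⟩
      | succ k ih =>
        obtain ⟨m, h1, h2⟩ := ih
        refine ⟨25 * m + 16, ?_, (hstep m).trans h2⟩
        -- This makes the division by `3` exact, so replacing `k` by `k + 1` replaces `m` by `25m +
        -- 16`.
        have h3 : 5 ^ (2 * (k + 1)) % 3 = 1 := by rw [pow_mul, Nat.pow_mod]; norm_num
        rw [show 2 * (k + 1 + 1) = 2 * (k + 1) + 2 by ring, pow_add _ _ 2]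
        generalize 5 ^ (2 * (k + 1)) = a at *
        have h4 : a * 5 ^ 2 * n = 25 * (a * n) := by ring
        rw [h4]
        generalize a * n = b at *
        omega
    obtain ⟨j, rfl⟩ := Nat.exists_eq_succ_of_ne_zero hk.ne'
    obtain ⟨m, h1, h2⟩ := hidx j
    rw [Nat.succ_eq_add_one, h1]
    exact h2
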